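/- Let $\Delta\subset\mathbb{R}^n$ be a Delzant polytope of dimension $n\ge 2$. That is, $\Delta$ is an $n$-dimensional polytope such that exactly $n$ edges meet at each vertex $v$, these edges lie one in each of the rays $\{v+t w_i : t\ge 0\}$, $i=1,\dots,n$, with $w_i\in\mathbb{Z}^n$, and $w_1,\dots,w_n$ can be chosen to be a $\mathbb{Z}$-basis of $\mathbb{Z}^n$; with such a choice, $w_1,\dots,w_n$ are called the weights at $v$. (The vertices need not be lattice points.) Let $\Delta[k]$ be the set of $k$-dimensional faces of $\Delta$; it is finite, and $f_k=|\Delta[k]|$. For each edge $e\in\Delta[1]$ with end points $u$ and $v$, let $w_1,\dots,w_n$ and $\tilde w_1,\dots,\tilde w_n$ be the weights at $u$ and at $v$, labeled so that $w_1$ and $\tilde w_1$ point along $e$ (so $\tilde w_1=-w_1$). Then for every $i\in\{2,\dots,n\}$ there is a unique integer $a_i^e$ such that $$w_i-\tilde w_{j_i}=a_i^e\,w_1\quad\text{for some } j_i\in\{2,\dots,n\}.$$ The integers $a_2^e,\dots,a_n^e$ are called the normal contributions of $e$. For every choice of the order of the end points of each edge and of the labelings of the weights, $$\sum_{e\in\Delta[1]}\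 \sum_{i=2}^n a_i^e \;=\; 12 f_2-3(n-1)f_1 .$$ -/

import Mathlib

namespace DelzantPolytope

variable {n : ℕ}

/-- An `n`-dimensional polytope in `ℝⁿ`: the convex hull of a finite nonempty set of points whose
affine span has dimension `n`. -/
def IsFullPolytope (Δ : Set (Fin n → ℝ)) : Prop :=
  (∃ S : Finset (Fin n → ℝ), S.Nonempty ∧ Δ = convexHull ℝ (S : Set (Fin n → ℝ))) ∧
    Module.finrank ℝ (vectorSpan ℝ Δ) = n

/-- `Δ[k]`: the set of `k`-dimensional faces of `Δ`. A face is a nonempty subset on which some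
linear functional attains its maximum over `Δ` (the zero functional gives `Δ` itself), and its
dimension is that of its affine span. -/
def faces (Δ : Set (Fin n → ℝ)) (k : ℕ) : Set (Set (Fin n → ℝ)) :=
  {F | F.Nonempty ∧ IsExposed ℝ Δ F ∧ Module.finrank ℝ (vectorSpan ℝ F) = k}

/-- The entry `f_k` of the `f`-vector: the number of `k`-dimensional faces. -/
noncomputable def fVector (Δ : Set (Fin n → ℝ)) (k : ℕ) : ℕ := (faces Δ k).ncard

/-- The vertices, as points. -/
def vertices (Δ : Set (Fin n → ℝ)) : Set (Fin n → ℝ) := {v | {v} ∈ faces Δ 0}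

/-- The edges meeting at the point `v`. -/
def edgesAt (Δ : Set (Fin n → ℝ)) (v : Fin n → ℝ) : Set (Set (Fin n → ℝ)) :=
  {e | e ∈ faces Δ 1 ∧ v ∈ e}

/-- The ray `{v + t w : t ≥ 0}` from `v` in the direction of the integral vector `w`. -/
def ray (v : Fin n → ℝ) (w : Fin n → ℤ) : Set (Fin n → ℝ) :=
  {x | ∃ t : ℝ, 0 ≤ t ∧ x = v + t • (fun i => (w i : ℝ))}

/-- `w 0, …, w (n - 1)` are the weights at `v`: they form a basis of the lattice `ℤⁿ` and they are
the directions of the edges of `Δ` meeting at `v`, one for each edge. -/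
def IsWeights (Δ : Set (Fin n → ℝ)) (v : Fin n → ℝ) (w : Fin n → Fin n → ℤ) : Prop :=
  (LinearIndependent ℤ w ∧ Submodule.span ℤ (Set.range w) = ⊤) ∧
    ∃ E : Fin n ≃ edgesAt Δ v, ∀ i, (E i : Set (Fin n → ℝ)) ⊆ ray v (w i)

/-- Delzant (smooth, unimodular) polytopes of dimension `n` in `ℝⁿ`, with respect to `ℤⁿ`.
The vertices need not be lattice points. -/
structure IsDelzant (Δ : Set (Fin n → ℝ)) : Prop where
  polytope : IsFullPolytope Δ
  /-- exactly `n` edges meet at each vertex -/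
  simple : ∀ v ∈ vertices Δ, (edgesAt Δ v).Finite ∧ (edgesAt Δ v).ncard = n
  /-- the edges have rational directions -/
  rational : ∀ v ∈ vertices Δ, ∀ e ∈ edgesAt Δ v, ∃ w : Fin n → ℤ, e ⊆ ray v w
  /-- the edge directions at a vertex can be chosen to be a basis of `ℤⁿ` -/
  smooth : ∀ v ∈ vertices Δ, ∃ w : Fin n → Fin n → ℤ, IsWeights Δ v w

/-- An ordering `u`, `v` of the two vertices of `Δ` on `e`, together with labelings of the weights
`w` at `u` and `w'` at `v` in which the first ones, `w 0` and `w' 0`, point along `e`. -/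
structure EdgeFrame [NeZero n] (Δ : Set (Fin n → ℝ)) (e : Set (Fin n → ℝ)) where
  u : Fin n → ℝ
  v : Fin n → ℝ
  w : Fin n → Fin n → ℤ
  w' : Fin n → Fin n → ℤ
  u_mem : u ∈ vertices Δ
  v_mem : v ∈ vertices Δ
  u_mem_edge : u ∈ e
  v_mem_edge : v ∈ e
  u_ne_v : u ≠ v
  weights_u : IsWeights Δ u w
  weights_v : IsWeights Δ v w'
  w_along : e ⊆ ray u (w 0)
  w'_along : e ⊆ ray v (w' 0)

/-- The integer `a` is the normal contribution of the edge belonging to the weight `w i`, `i ≠ 0`,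
at `u`: one has `w i - w' j = a • w 0` for some weight `w' j`, `j ≠ 0`, at `v`. -/
def EdgeFrame.IsNormalContribution [NeZero n] {Δ e : Set (Fin n → ℝ)} (fr : EdgeFrame Δ e)
    (i : Fin n) (a : ℤ) : Prop :=
  ∃ j : Fin n, j ≠ 0 ∧ fr.w i - fr.w' j = a • fr.w 0

end DelzantPolytope

/-! Near a vertex, `Δ` is the cone on the weights (`Chart.C_nonneg`), so the faces through a vertex
correspond to the sets of edges there (`Chart.eq_face`). Hence each edge `e` lies in exactly `n - 1`
two-faces, one for each remaining weight, and the contribution of `e` for that weight depends only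
on the pair `e ⊆ F` (`EdgeFrame.exists_chart`). Summing over two-faces instead of edges reduces the
theorem to Noether's formula for one Delzant polygon `F`: its contributions add up to `12 - 3 ·
#edges` (`IsDelzant.sum_contribution_face`).

For the polygon, evaluate the weights on an integral functional that vanishes on none of them. If
the weights at a vertex take the values `p` and `q`, the contributions regroup into the sum of `p/q
+ q/p` over the vertices. As `p` and `q` are coprime, Dedekind reciprocity (`dedekind_recip`)
replaces this by `12 (s(p,q) + s(q,p)) - 1/(pq) + 3 sign(pq)`. The Dedekind sums cancel in pairs
along edges, by periodicity and oddness; the terms `1/(pq)` add up to zero, as in localization. Only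
the signs remain (`sum_contribution_eq_sum_sign`), and `pq > 0` exactly at the minimum and the
maximum of the functional. -/

namespace DelzantPolytope

/-! ### Dedekind sums and their reciprocity law -/

/-- The Dedekind sum `s(h, k)` of coprime `h` and `k`, computed by the Euclidean algorithm from the
reciprocity law. -/
def dedekindNat (h k : ℕ) : ℚ :=
  -- For coprime arguments with `k > 0`, `k ∣ h` forces `k = 1`, where the Dedekind sum does vanish;
  -- in all other cases `0` is a default value.
  if hk : k = 0 ∨ h % k = 0 then 0
  else (((h % k : ℕ) : ℚ) ^ 2 + (k : ℚ) ^ 2 + 1) / (12 * ((h % k : ℕ) : ℚ) * k) - 1 / 4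
    - dedekindNat k (h % k)
termination_by k
decreasing_by exact Nat.mod_lt _ (Nat.pos_of_ne_zero (fun h0 => hk (Or.inl h0)))

theorem dedekindNat_mod (h k : ℕ) : dedekindNat (h % k) k = dedekindNat h k := by
  rw [dedekindNat, dedekindNat.eq_def h k]
  simp only [Nat.mod_mod]

theorem dedekindNat_add (h k : ℕ) : dedekindNat (h + k) k = dedekindNat h k := by
  rw [← dedekindNat_mod (h + k), Nat.add_mod_right, dedekindNat_mod]

theorem dedekindNat_one (h : ℕ) : dedekindNat h 1 = 0 := by
  rw [dedekindNat]; simp [Nat.mod_one]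

theorem dedekindNat_recip_lt {h k : ℕ} (h0 : 0 < h) (hk : h < k) :
    dedekindNat h k + dedekindNat k h = ((h : ℚ) ^ 2 + (k : ℚ) ^ 2 + 1) / (12 * h * k) - 1 / 4 := by
  rw [dedekindNat.eq_def h k, dif_neg, Nat.mod_eq_of_lt hk]
  · ring
  · rw [Nat.mod_eq_of_lt hk]; omega

theorem dedekindNat_recip {h k : ℕ} (h0 : 0 < h) (k0 : 0 < k) (hc : Nat.Coprime h k) :
    dedekindNat h k + dedekindNat k h = ((h : ℚ) ^ 2 + (k : ℚ) ^ 2 + 1) / (12 * h * k) - 1 / 4 := by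
  rcases lt_trichotomy h k with hlt | rfl | hlt
  · exact dedekindNat_recip_lt h0 hlt
  · obtain rfl : h = 1 := by simpa using hc
    rw [dedekindNat_one]; norm_num
  · rw [add_comm, dedekindNat_recip_lt k0 hlt]; ring

/-- This is oddness in the numerator, since `r ≡ -h` modulo `h + r`. Reciprocity for the pairs `(r,
h + r)` and `(h, h + r)` leaves `s(h, r) + s(r, h)` after reduction, and reciprocity for `(h, r)`
evaluates it; no induction is needed. -/
theorem dedekindNat_sub {h r : ℕ} (h0 : 0 < h) (r0 : 0 < r) (hc : Nat.Coprime h r) :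
    dedekindNat r (h + r) = - dedekindNat h (h + r) := by
  have e1 := dedekindNat_recip_lt r0 (show r < h + r by omega)
  have e2 := dedekindNat_recip_lt h0 (show h < h + r by omega)
  have e3 := dedekindNat_recip h0 r0 hc
  rw [dedekindNat_add] at e1
  rw [add_comm h r, dedekindNat_add, add_comm r h] at e2
  have hh : (h : ℚ) ≠ 0 := by positivity
  have hr : (r : ℚ) ≠ 0 := by positivity
  have hs : (h : ℚ) + r ≠ 0 := by positivity
  have key : ((r : ℚ) ^ 2 + ((h + r : ℕ) : ℚ) ^ 2 + 1) / (12 * r * ((h + r : ℕ) : ℚ)) - 1 / 4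
      + (((h : ℚ) ^ 2 + ((h + r : ℕ) : ℚ) ^ 2 + 1) / (12 * h * ((h + r : ℕ) : ℚ)) - 1 / 4)
      = ((h : ℚ) ^ 2 + (r : ℚ) ^ 2 + 1) / (12 * h * r) - 1 / 4 := by
    push_cast
    field_simp
    ring
  linarith

/-- The Dedekind sum, odd in its second argument. -/
def dedekind (b a : ℤ) : ℚ := (a.sign : ℚ) * dedekindNat (b % a).toNat a.natAbs

theorem dedekind_add_mul (b a k : ℤ) : dedekind (b + k * a) a = dedekind b a := by
  simp [dedekind]

theorem dedekind_neg_right (b a : ℤ) : dedekind b (-a) = - dedekind b a := by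
  simp [dedekind, Int.sign_neg]

theorem dedekind_natCast (b : ℕ) {a : ℕ} (ha : 0 < a) : dedekind b a = dedekindNat b a := by
  have : (a : ℤ).sign = 1 := Int.sign_eq_one_of_pos (by exact_mod_cast ha)
  simp only [dedekind, this, Int.natAbs_natCast]
  rw [← dedekindNat_mod b a, ← Int.natCast_mod, Int.toNat_natCast]
  simp

theorem dedekind_neg_left {b a : ℕ} (ha : 0 < a) (hc : Nat.Coprime b a) :
    dedekind (-(b : ℤ)) a = - dedekindNat b a := by
  rcases Nat.eq_zero_or_pos (b % a) with h0 | h0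
  · have hd : a ∣ b := Nat.dvd_of_mod_eq_zero h0
    obtain rfl : a = 1 := Nat.eq_one_of_dvd_coprimes hc hd dvd_rfl
    simp [dedekind, dedekindNat_one]
  · have hlt : b % a < a := Nat.mod_lt _ ha
    have hc' : Nat.Coprime (b % a) a := by
      rw [Nat.Coprime, ← hc]; exact (Nat.mod_modEq b a).gcd_eq
    obtain ⟨r, hr⟩ : ∃ r, a = b % a + r := ⟨a - b % a, by omega⟩
    have e : (-(b : ℤ)) = (r : ℤ) + (-(b / a : ℕ) - 1) * (a : ℤ) := by
      have h1 := Nat.div_add_mod b a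
      have h2 : (b : ℤ) = a * (b / a : ℕ) + (b % a : ℕ) := by exact_mod_cast h1.symm
      have h3 : (a : ℤ) = (b % a : ℕ) + r := by exact_mod_cast hr
      linear_combination -h2 + h3
    rw [e, dedekind_add_mul, dedekind_natCast _ ha, ← dedekindNat_mod b a]
    have hr0 : 0 < r := by omega
    have hcr : Nat.Coprime (b % a) r := by
      rw [hr] at hc'
      have : Nat.Coprime (b % a) (b % a + r) := by rw [← hr] at hc'; rw [← hr]; exact hc'
      simpa using this
    have := dedekindNat_sub h0 hr0 hcr
    rw [← hr] at this
    exact this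

/-- Oddness in both arguments reduces every sign pattern to natural numbers. The fraction is odd in
each variable too, so the constant `1/4` must acquire the sign of `a * b`. -/
theorem dedekind_recip {a b : ℤ} (ha : a ≠ 0) (hb : b ≠ 0) (hc : IsCoprime a b) :
    dedekind a b + dedekind b a =
      ((a : ℚ) ^ 2 + (b : ℚ) ^ 2 + 1) / (12 * a * b) - ((a * b).sign : ℚ) / 4 := by
  have hcn : Nat.Coprime a.natAbs b.natAbs := Int.isCoprime_iff_gcd_eq_one.mp hc
  have main : ∀ a b : ℕ, 0 < a → 0 < b → Nat.Coprime a b →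
      dedekind a (-(b : ℤ)) + dedekind (-(b : ℤ)) a =
        -(((a : ℚ) ^ 2 + (b : ℚ) ^ 2 + 1) / (12 * a * b) - 1 / 4) := by
    intro a b ha hb hc
    rw [dedekind_neg_right, dedekind_natCast _ hb, dedekind_neg_left ha hc.symm,
      ← dedekindNat_recip ha hb hc]
    ring
  rw [Int.sign_mul]
  rcases Int.natAbs_eq a with h1 | h1 <;> rcases Int.natAbs_eq b with h2 | h2 <;>
    have ha' : 0 < a.natAbs := Int.natAbs_pos.mpr ha <;>
    have hb' : 0 < b.natAbs := Int.natAbs_pos.mpr hb <;>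
    generalize a.natAbs = x at * <;> generalize b.natAbs = y at * <;> subst h1 <;> subst h2 <;>
    have sx : (x : ℤ).sign = 1 := Int.sign_eq_one_of_pos (by exact_mod_cast ha') <;>
    have sy : (y : ℤ).sign = 1 := Int.sign_eq_one_of_pos (by exact_mod_cast hb') <;>
    simp only [Int.sign_neg, sx, sy]
  · rw [dedekind_natCast _ ha', dedekind_natCast _ hb', dedekindNat_recip ha' hb' hcn]
    push_cast; ring
  · rw [main x y ha' hb' hcn]
    push_cast
    ring
  · rw [add_comm, main y x hb' ha' hcn.symm]
    push_cast
    ring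
  · rw [dedekind_neg_right, dedekind_neg_right, dedekind_neg_left hb' hcn,
      dedekind_neg_left ha' hcn.symm, neg_neg, neg_neg, dedekindNat_recip ha' hb' hcn]
    push_cast; ring

/-! ### Contributions of a polygon as a sum of signs -/

/-- The flags of a unimodular lattice polygon: `σ` exchanges the edges at a vertex, `τ` the vertices
of an edge, and `(α x, η x)` is the primitive vector along the edge pointing away from the vertex. -/
theorem sum_contribution_eq_sum_sign {ι : Type*} (X : Finset ι) (σ τ : ι → ι)
    (hσ : ∀ x ∈ X, σ x ∈ X) (hτ : ∀ x ∈ X, τ x ∈ X)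
    (hσσ : ∀ x ∈ X, σ (σ x) = x) (hττ : ∀ x ∈ X, τ (τ x) = x)
    (α η a : ι → ℤ) (hα : ∀ x ∈ X, α (τ x) = - α x) (hη : ∀ x ∈ X, η (τ x) = - η x)
    (haα : ∀ x ∈ X, α (σ x) - α (σ (τ x)) = a x * α x)
    (haη : ∀ x ∈ X, η (σ x) - η (σ (τ x)) = a x * η x)
    (hdet : ∀ x ∈ X, (α x * η (σ x) - η x * α (σ x)) ^ 2 = 1)
    (hne : ∀ x ∈ X, α x ≠ 0) :
    ∑ x ∈ X, a x = 3 * ∑ x ∈ X, (α x * α (σ x)).sign := by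
  have sσ : ∀ f : ι → ℚ, ∑ x ∈ X, f (σ x) = ∑ x ∈ X, f x := fun f =>
    Finset.sum_nbij' σ σ hσ hσ hσσ hσσ (fun _ _ => rfl)
  have sτ : ∀ f : ι → ℚ, ∑ x ∈ X, f (τ x) = ∑ x ∈ X, f x := fun f =>
    Finset.sum_nbij' τ τ hτ hτ hττ hττ (fun _ _ => rfl)
  have hneq : ∀ x ∈ X, (α x : ℚ) ≠ 0 := fun x hx => by exact_mod_cast hne x hx
  -- the sum of the contributions as a sum over vertices
  have h1 : ∑ x ∈ X, (a x : ℚ) = ∑ x ∈ X, ((α (σ x) : ℚ) / α x + (α x : ℚ) / α (σ x)) := by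
    have e1 : ∀ x ∈ X, (a x : ℚ) = (α (σ x) : ℚ) / α x + (α (σ (τ x)) : ℚ) / α (τ x) := by
      intro x hx
      have := haα x hx
      have h' : (α (σ x) : ℚ) - α (σ (τ x)) = a x * α x := by exact_mod_cast this
      rw [hα x hx]
      have := hneq x hx
      push_cast
      field_simp
      linarith
    rw [Finset.sum_congr rfl e1, Finset.sum_add_distrib, Finset.sum_add_distrib,
      sτ (fun x => (α (σ x) : ℚ) / α x)]
    congr 1
    rw [← sσ (fun x => (α (σ x) : ℚ) / α x)]
    refine Finset.sum_congr rfl fun x hx => ?_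
    simp only [hσσ x hx]
  -- the Dedekind sums cancel along edges
  have h2 : ∑ x ∈ X, dedekind (α (σ x)) (α x) = 0 := by
    have e : ∑ x ∈ X, dedekind (α (σ x)) (α x) = - ∑ x ∈ X, dedekind (α (σ x)) (α x) := by
      rw [← Finset.sum_neg_distrib, ← sτ]
      refine Finset.sum_congr rfl fun x hx => ?_
      rw [hα x hx, dedekind_neg_right]
      have : α (σ (τ x)) = α (σ x) + (- a x) * α x := by linarith [haα x hx]
      rw [this, dedekind_add_mul]
    linarith
  have h3 : ∑ x ∈ X, dedekind (α x) (α (σ x)) = 0 := by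
    rw [← h2, ← sσ]
    refine Finset.sum_congr rfl fun x hx => ?_
    simp only [hσσ x hx]
  -- localization of the integral of `1`
  let c : ι → ℚ := fun x => (α x * η (σ x) - η x * α (σ x) : ℤ)
  have hcσ : ∀ x ∈ X, c (σ x) = - c x := by
    intro x hx; simp only [c, hσσ x hx]; push_cast; ring
  have hcτ : ∀ x ∈ X, c (τ x) = - c x := by
    intro x hx
    have e1 : α (σ (τ x)) = α (σ x) - a x * α x := by linarith [haα x hx]
    have e2 : η (σ (τ x)) = η (σ x) - a x * η x := by linarith [haη x hx]
    simp only [c, hα x hx, hη x hx, e1, e2]; push_cast; ring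
  have h4 : ∑ x ∈ X, 1 / ((α x : ℚ) * α (σ x)) = 0 := by
    -- Since `c x ^ 2 = 1`, the left side is `c x / (α x * α (σ x))` times the determinant `c x`,
    -- which splits into one term per edge at the vertex. Along an edge `c` changes sign while `η /
    -- α` does not, so these terms cancel.
    have e : ∀ x ∈ X, 1 / ((α x : ℚ) * α (σ x)) =
        - (c (σ x) * (η (σ x) / α (σ x))) - c x * (η x / α x) := by
      intro x hx
      have hd : (c x) ^ 2 = 1 := by simp only [c]; exact_mod_cast hdet x hx
      have n1 := hneq x hx
      have n2 := hneq _ (hσ x hx)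
      have hc' : c x = α x * η (σ x) - η x * α (σ x) := by simp only [c]; push_cast; ring
      rw [hcσ x hx, ← hd]
      field_simp
      rw [pow_two]
      nth_rewrite 2 [hc']
      ring
    have e0 : ∑ x ∈ X, c x * (η x / α x) = 0 := by
      have : ∑ x ∈ X, c x * ((η x : ℚ) / α x) = - ∑ x ∈ X, c x * ((η x : ℚ) / α x) := by
        rw [← Finset.sum_neg_distrib, ← sτ]
        refine Finset.sum_congr rfl fun x hx => ?_
        rw [hcτ x hx, hα x hx, hη x hx]
        push_cast
        rw [neg_div_neg_eq]
        ring
      linarith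
    rw [Finset.sum_congr rfl e, Finset.sum_sub_distrib, Finset.sum_neg_distrib,
      sσ (fun x => c x * (η x / α x)), e0]
    simp
  have h5 : ∀ x ∈ X, (α (σ x) : ℚ) / α x + (α x : ℚ) / α (σ x) =
      12 * (dedekind (α x) (α (σ x)) + dedekind (α (σ x)) (α x))
        - 1 / ((α x : ℚ) * α (σ x)) + 3 * ((α x * α (σ x)).sign : ℚ) := by
    intro x hx
    -- The determinant squared being `1` is a Bézout relation.
    have hco : IsCoprime (α x) (α (σ x)) := by
      have hd := hdet x hx
      refine ⟨(α x * η (σ x) - η x * α (σ x)) * η (σ x),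
        - (α x * η (σ x) - η x * α (σ x)) * η x, ?_⟩
      linear_combination hd
    have n1 := hneq x hx
    have n2 := hneq _ (hσ x hx)
    rw [dedekind_recip (hne x hx) (hne _ (hσ x hx)) hco]
    field_simp
    ring
  have : ∑ x ∈ X, (a x : ℚ) = 3 * ∑ x ∈ X, ((α x * α (σ x)).sign : ℚ) := by
    rw [h1, Finset.sum_congr rfl h5, Finset.sum_add_distrib, Finset.sum_sub_distrib,
      ← Finset.mul_sum, Finset.sum_add_distrib, h2, h3, h4, ← Finset.mul_sum]
    ring
  exact_mod_cast this

/-! ### Faces and vertices of polytopes -/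

variable {n : ℕ}

theorem convexHull_le_of_forall_le {E : Type*} [AddCommGroup E] [Module ℝ E] {S : Set E}
    (l : E →ₗ[ℝ] ℝ) {c : ℝ} (h : ∀ s ∈ S, l s ≤ c) : ∀ x ∈ convexHull ℝ S, l x ≤ c :=
  convexHull_min h (convex_halfSpace_le l.isLinear c)

theorem convexHull_extremePoints_eq {K : Set (Fin n → ℝ)} (hK : IsCompact K) (hc : Convex ℝ K)
    (hf : (K.extremePoints ℝ).Finite) : convexHull ℝ (K.extremePoints ℝ) = K := by
  conv_rhs => rw [← closure_convexHull_extremePoints hK hc]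
  exact (Set.Finite.isClosed_convexHull ℝ hf).closure_eq.symm

/-- A polytope: the convex hull of a finite set. -/
def IsPolytope (Δ : Set (Fin n → ℝ)) : Prop :=
  ∃ S : Finset (Fin n → ℝ), Δ = convexHull ℝ (S : Set (Fin n → ℝ))

namespace IsPolytope

variable {Δ F G : Set (Fin n → ℝ)}

theorem convex (h : IsPolytope Δ) : Convex ℝ Δ := by
  obtain ⟨S, rfl⟩ := h; exact convex_convexHull ℝ _

theorem isCompact (h : IsPolytope Δ) : IsCompact Δ := by
  obtain ⟨S, rfl⟩ := h; exact S.finite_toSet.isCompact_convexHull ℝ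

theorem finite_extremePoints (h : IsPolytope Δ) : (Δ.extremePoints ℝ).Finite := by
  obtain ⟨S, rfl⟩ := h; exact S.finite_toSet.subset extremePoints_convexHull_subset

theorem convexHull_extremePoints_face (h : IsPolytope Δ) (hF : IsExposed ℝ Δ F) :
    convexHull ℝ (F.extremePoints ℝ) = F :=
  convexHull_extremePoints_eq (hF.isCompact h.isCompact) (hF.convex h.convex)
    (h.finite_extremePoints.subset hF.isExtreme.extremePoints_subset_extremePoints)

theorem face (h : IsPolytope Δ) (hF : IsExposed ℝ Δ F) : IsPolytope F := by
  have hf := h.finite_extremePoints.subset hF.isExtreme.extremePoints_subset_extremePoints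
  exact ⟨hf.toFinset, by rw [hf.coe_toFinset, h.convexHull_extremePoints_face hF]⟩

/-- A face is the hull of its extreme points, which are among the finitely many extreme points of
`Δ`. -/
theorem finite_faces (h : IsPolytope Δ) (k : ℕ) : (faces Δ k).Finite := by
  refine Set.Finite.of_finite_image (f := fun F => F.extremePoints ℝ) ?_ ?_
  · refine h.finite_extremePoints.finite_subsets.subset ?_
    rintro _ ⟨F, hF, rfl⟩
    exact hF.2.1.isExtreme.extremePoints_subset_extremePoints
  · intro F hF G hG hFG
    rw [← h.convexHull_extremePoints_face hF.2.1, ← h.convexHull_extremePoints_face hG.2.1]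
    exact congrArg _ hFG

/-- If `l` exposes `F` in `Δ` and `l'` exposes `G` in `F`, then `M • l + l'` exposes `G` for large
`M`. A uniform `M` exists because only finitely many generators have to be compared. -/
theorem exposed_trans (h : IsPolytope Δ) (hF : IsExposed ℝ Δ F) (hG : IsExposed ℝ F G) :
    IsExposed ℝ Δ G := by
  intro hGne
  obtain ⟨g, hg⟩ := hGne
  obtain ⟨l', hl'⟩ := hG ⟨g, hg⟩
  obtain ⟨l, hl⟩ := hF ⟨g, hG.subset hg⟩
  have hgF := hG.subset hg
  obtain ⟨S, hS⟩ := h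
  have lmax : ∀ x ∈ Δ, l x ≤ l g := fun x hx => by rw [hl] at hgF; exact hgF.2 x hx
  have l'max : ∀ x ∈ F, l' x ≤ l' g := fun x hx => by rw [hl'] at hg; exact hg.2 x hx
  have memF : ∀ x ∈ Δ, l x = l g → x ∈ F := fun x hx e => by
    rw [hl]; exact ⟨hx, fun y hy => e ▸ lmax y hy⟩
  have hM : ∃ M : ℝ, ∀ s ∈ S, M * l s + l' s ≤ M * l g + l' g := by
    have : ∀ s ∈ S, ∃ M₀ : ℝ, ∀ M ≥ M₀, M * l s + l' s ≤ M * l g + l' g := by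
      intro s hs
      have hsΔ : s ∈ Δ := by rw [hS]; exact subset_convexHull ℝ _ hs
      rcases (lmax s hsΔ).eq_or_lt with e | e
      · exact ⟨0, fun M _ => by rw [e]; linarith [l'max s (memF s hsΔ e)]⟩
      · refine ⟨(l' s - l' g) / (l g - l s), fun M hM => ?_⟩
        rw [ge_iff_le, div_le_iff₀ (by linarith)] at hM
        linarith
    choose! f hf using this
    obtain ⟨M, hM⟩ := (S.image f).bddAbove
    exact ⟨M, fun s hs => hf s hs M (hM (by simpa using ⟨s, hs, rfl⟩))⟩
  obtain ⟨M, hM⟩ := hM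
  have hMΔ : ∀ x ∈ Δ, M * l x + l' x ≤ M * l g + l' g := by
    rw [hS]
    exact convexHull_le_of_forall_le (S := (S : Set (Fin n → ℝ)))
      ((M • l + l' : StrongDual ℝ (Fin n → ℝ)) : (Fin n → ℝ) →ₗ[ℝ] ℝ) hM
  -- `M` only gives a weak inequality; the additional `l` forces every maximizer to maximize `l`,
  -- hence to lie in `F`.
  refine ⟨(M + 1) • l + l', ?_⟩
  ext x
  simp only [Set.mem_ofPred_eq, add_apply, smul_apply,
    smul_eq_mul]
  constructor
  · intro hx
    have hxF := hG.subset hx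
    have hxΔ := hF.subset hxF
    have e1 : l x = l g := by
      refine le_antisymm (lmax x hxΔ) ?_
      rw [hl] at hxF; exact hxF.2 g (hF.subset hgF)
    have e2 : l' x = l' g := by
      refine le_antisymm (l'max x hxF) ?_
      rw [hl'] at hx; exact hx.2 g hgF
    refine ⟨hxΔ, fun y hy => ?_⟩
    rw [e1, e2]
    linarith [hMΔ y hy, lmax y hy]
  · rintro ⟨hxΔ, hx⟩
    have h1 := hx g (hF.subset hgF)
    have h2 := hMΔ x hxΔ
    have e1 : l x = l g := le_antisymm (lmax x hxΔ) (by linarith)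
    have hxF := memF x hxΔ e1
    have e2 : l' g ≤ l' x := by rw [e1] at h1; linarith
    rw [hl']
    exact ⟨hxF, fun y hy => (l'max y hy).trans e2⟩

theorem mem_vertices_of_isExposed {v : Fin n → ℝ} (h : IsExposed ℝ Δ {v}) : v ∈ vertices Δ :=
  ⟨Set.singleton_nonempty v, h, by rw [vectorSpan_singleton, finrank_bot]⟩

/-- A point `x` of `F` farthest from the origin is exposed by `y ↦ ⟨x, y⟩`, because `2⟨x, y⟩ + |x -
y|² = |x|² + |y|² ≤ 2|x|²` on `F`. -/
theorem exists_vertex_mem (h : IsPolytope Δ) (hF : IsExposed ℝ Δ F) (hne : F.Nonempty) :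
    ∃ v ∈ F, v ∈ vertices Δ := by
  obtain ⟨x, hx, hmax⟩ := (hF.isCompact h.isCompact).exists_isMaxOn hne
    (f := fun x : Fin n → ℝ => ∑ i, x i ^ 2) (by fun_prop)
  refine ⟨x, hx, mem_vertices_of_isExposed (h.exposed_trans hF fun _ => ?_)⟩
  let l : StrongDual ℝ (Fin n → ℝ) := ∑ i, x i • ContinuousLinearMap.proj i
  have hl : ∀ y, l y = ∑ i, x i * y i := fun y => by
    simp [l]
  have key : ∀ y ∈ F, 2 * l y + ∑ i, (x i - y i) ^ 2 ≤ 2 * l x := by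
    intro y hy
    have h1 : ∑ i, y i ^ 2 ≤ ∑ i, x i ^ 2 := hmax hy
    rw [hl, hl]
    have h2 : ∑ i, (x i - y i) ^ 2 = ∑ i, x i ^ 2 - 2 * ∑ i, x i * y i + ∑ i, y i ^ 2 := by
      rw [Finset.mul_sum, ← Finset.sum_sub_distrib, ← Finset.sum_add_distrib]
      exact Finset.sum_congr rfl fun i _ => by ring
    have h3 : ∑ i, x i * x i = ∑ i, x i ^ 2 := Finset.sum_congr rfl fun i _ => by ring
    linarith
  refine ⟨l, Set.Subset.antisymm ?_ ?_⟩
  · rw [Set.singleton_subset_iff]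
    refine ⟨hx, fun y hy => ?_⟩
    have : 0 ≤ ∑ i, (x i - y i) ^ 2 := Finset.sum_nonneg fun i _ => sq_nonneg _
    linarith [key y hy]
  · rintro y ⟨hy, hymax⟩
    have h0 : 0 ≤ ∑ i, (x i - y i) ^ 2 := Finset.sum_nonneg fun i _ => sq_nonneg _
    have h1 : ∑ i, (x i - y i) ^ 2 = 0 := by linarith [key y hy, hymax x hx]
    rw [Finset.sum_eq_zero_iff_of_nonneg fun i _ => sq_nonneg _] at h1
    ext i
    have := pow_eq_zero_iff (two_ne_zero) |>.mp (h1 i (Finset.mem_univ i))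
    linarith

/-- Every linear functional attains its minimum on a face at a vertex of the polytope. -/
theorem exists_vertex_forall_le (h : IsPolytope Δ) (hF : IsExposed ℝ Δ F) (hne : F.Nonempty)
    (l : StrongDual ℝ (Fin n → ℝ)) : ∃ v ∈ F, v ∈ vertices Δ ∧ ∀ x ∈ F, l v ≤ l x := by
  have hG : IsExposed ℝ F ((-l).toExposed F) := ContinuousLinearMap.toExposed.isExposed
  obtain ⟨x, hx, hmin⟩ := (hF.isCompact h.isCompact).exists_isMinOn hne l.continuous.continuousOn
  have hne' : ((-l).toExposed F).Nonempty := ⟨x, hx, fun y hy => by simpa using hmin hy⟩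
  obtain ⟨v, hv, hv'⟩ := h.exists_vertex_mem (h.exposed_trans hF hG) hne'
  exact ⟨v, hv.1, hv', fun y hy => by simpa using hv.2 y hy⟩

end IsPolytope

/-! ### Lattice coordinates at a vertex -/

/-- The real vector with integral coordinates `w`. -/
def realVec (w : Fin n → ℤ) : Fin n → ℝ := fun i => (w i : ℝ)

/-- The linear functional on `ℝⁿ` with integral coefficients `N`. -/
noncomputable def realDual (N : Fin n → ℤ) : StrongDual ℝ (Fin n → ℝ) :=
  ∑ k, (N k : ℝ) • ContinuousLinearMap.proj k

theorem realDual_apply (N : Fin n → ℤ) (x : Fin n → ℝ) : realDual N x = ∑ k, (N k : ℝ) * x k := by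
  simp [realDual]

theorem realDual_realVec (N w : Fin n → ℤ) : realDual N (realVec w) = ((N ⬝ᵥ w : ℤ) : ℝ) := by
  simp [realDual_apply, realVec, dotProduct]

theorem realVec_injective : Function.Injective (realVec (n := n)) := fun v w h => by
  ext i
  have : (v i : ℝ) = w i := congrFun h i
  exact_mod_cast this

theorem realVec_neg (v : Fin n → ℤ) : realVec (-v) = - realVec v := by
  ext; simp [realVec]

theorem mem_ray {v : Fin n → ℝ} {w : Fin n → ℤ} {x : Fin n → ℝ} :
    x ∈ ray v w ↔ ∃ t : ℝ, 0 ≤ t ∧ x = v + t • realVec w := Iff.rfl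

/-- The weights at `v` together with the edges they span and the dual basis. -/
structure Chart (Δ : Set (Fin n → ℝ)) (v : Fin n → ℝ) where
  w : Fin n → Fin n → ℤ
  edge : Fin n ≃ edgesAt Δ v
  edge_subset : ∀ i, (edge i : Set (Fin n → ℝ)) ⊆ ray v (w i)
  N : Fin n → Fin n → ℤ
  dual : ∀ i j, N i ⬝ᵥ w j = if i = j then 1 else 0
  sum_dual : ∀ x : Fin n → ℤ, ∑ i, (N i ⬝ᵥ x) • w i = x

theorem IsWeights.exists_chart {Δ : Set (Fin n → ℝ)} {v : Fin n → ℝ} {w : Fin n → Fin n → ℤ}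
    (h : IsWeights Δ v w) : ∃ c : Chart Δ v, c.w = w := by
  obtain ⟨⟨hli, hsp⟩, E, hE⟩ := h
  let b : Module.Basis (Fin n) ℤ (Fin n → ℤ) := Module.Basis.mk hli hsp.ge
  have hb : ∀ i, b i = w i := fun i => by simp [b]
  have key : ∀ i x, (fun k => b.coord i (Pi.single k 1)) ⬝ᵥ x = b.coord i x := by
    intro i x
    conv_rhs => rw [← Finset.univ_sum_single x, map_sum]
    refine Finset.sum_congr rfl fun k _ => ?_
    rw [show (Pi.single k (x k) : Fin n → ℤ) = x k • Pi.single k 1 by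
      rw [← Pi.single_smul]; simp, map_smul, smul_eq_mul, mul_comm]
  refine ⟨⟨w, E, hE, fun i k => b.coord i (Pi.single k 1), ?_, ?_⟩, rfl⟩
  · intro i j
    rw [key, ← hb, b.coord_apply, b.repr_self, Finsupp.single_apply]
    simp only [eq_comm]
  · intro x
    simp_rw [key, ← hb]
    exact b.sum_repr x

namespace Chart

variable {Δ F : Set (Fin n → ℝ)} {v : Fin n → ℝ} (c : Chart Δ v)

/-- The real coordinates with respect to the weights. -/
noncomputable def C (i : Fin n) : StrongDual ℝ (Fin n → ℝ) := realDual (c.N i)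

theorem C_w (i j : Fin n) : c.C i (realVec (c.w j)) = if i = j then 1 else 0 := by
  rw [C, realDual_realVec, c.dual]; split <;> simp

theorem C_realVec (i : Fin n) (x : Fin n → ℤ) : c.C i (realVec x) = ((c.N i ⬝ᵥ x : ℤ) : ℝ) :=
  realDual_realVec _ _

theorem sum_C (x : Fin n → ℝ) : ∑ i, c.C i x • realVec (c.w i) = x := by
  have h : ∀ k : Fin n, ∀ l, ∑ i, c.N i k * c.w i l = if k = l then 1 else 0 := by
    intro k l
    have := congrFun (c.sum_dual (Pi.single k 1)) l
    simpa [Finset.sum_apply, Pi.single_apply, eq_comm] using this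
  ext l
  simp only [C, realDual_apply, Finset.sum_apply, Pi.smul_apply, smul_eq_mul, realVec,
    Finset.sum_mul]
  rw [Finset.sum_comm]
  have : ∀ k, ∑ i, (c.N i k : ℝ) * x k * (c.w i l : ℝ) = if k = l then x k else 0 := by
    intro k
    have h' : ∑ i, (c.N i k : ℝ) * (c.w i l : ℝ) = if k = l then 1 else 0 := by
      exact_mod_cast h k l
    calc _ = x k * ∑ i, (c.N i k : ℝ) * (c.w i l : ℝ) := by
          rw [Finset.mul_sum]; exact Finset.sum_congr rfl fun i _ => by ring
      _ = _ := by rw [h']; split <;> simp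
  rw [Finset.sum_congr rfl fun k _ => this k]
  simp

end Chart

theorem vectorSpan_eq_of_mem {F : Set (Fin n → ℝ)} {v : Fin n → ℝ} (hv : v ∈ F)
    {T : Submodule ℝ (Fin n → ℝ)} (h₁ : ∀ x ∈ F, x - v ∈ T)
    (h₂ : T ≤ Submodule.span ℝ ((fun x => x - v) '' F)) : vectorSpan ℝ F = T := by
  rw [vectorSpan_eq_span_vsub_set_right ℝ hv]
  refine le_antisymm ?_ h₂
  rw [Submodule.span_le]
  rintro _ ⟨x, hx, rfl⟩
  exact h₁ x hx

/-! ### The cone at a vertex and the faces through it -/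

namespace Chart

variable {Δ F : Set (Fin n → ℝ)} {v : Fin n → ℝ}

/-- A polytope lies in the cone generated by the edges at a vertex. -/
theorem C_nonneg (c : Chart Δ v) (h : IsPolytope Δ) (hv : v ∈ vertices Δ) {x : Fin n → ℝ}
    (hx : x ∈ Δ) (i : Fin n) : 0 ≤ c.C i (x - v) := by
  obtain ⟨l, hl⟩ := hv.2.1 (Set.singleton_nonempty v)
  have hvΔ : v ∈ Δ := hv.2.1.subset rfl
  have hlt : ∀ x ∈ Δ, x ≠ v → l x < l v := by
    intro x hx hxv
    have hvm : v ∈ ({v} : Set (Fin n → ℝ)) := rfl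
    rw [hl] at hvm
    refine (hvm.2 x hx).lt_of_ne fun e => hxv ?_
    have : x ∈ ({v} : Set (Fin n → ℝ)) := by
      rw [hl]; exact ⟨hx, fun y hy => e ▸ hvm.2 y hy⟩
    exact this
  have hS := h.convexHull_extremePoints_face (IsExposed.refl Δ)
  have hSΔ : Δ.extremePoints ℝ ⊆ Δ := extremePoints_subset
  -- `b s` is the direction from `v` to `s`, scaled so that `l` equals `-1`. The hull of these
  -- directions is the vertex figure of `Δ` at `v`.
  let b : (Fin n → ℝ) → (Fin n → ℝ) := fun s => (l v - l s)⁻¹ • (s - v)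
  let B : Set (Fin n → ℝ) := b '' (Δ.extremePoints ℝ \ {v})
  have hBfin : B.Finite := (h.finite_extremePoints.subset Set.sdiff_subset).image b
  have hb : ∀ s ∈ Δ, s ≠ v → s - v = (l v - l s) • b s := by
    intro s hs hsv
    have : l v - l s ≠ 0 := by linarith [hlt s hs hsv]
    simp only [b, smul_smul, mul_inv_cancel₀ this, one_smul]
  have hlb : ∀ s ∈ Δ, s ≠ v → l (b s) = -1 := by
    intro s hs hsv
    have : l v - l s ≠ 0 := by linarith [hlt s hs hsv]
    simp only [b, map_smul, map_sub, smul_eq_mul]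
    field_simp
    ring
  have hA := convexHull_extremePoints_eq (hBfin.isCompact_convexHull ℝ) (convex_convexHull ℝ B)
    (hBfin.subset extremePoints_convexHull_subset)
  -- An extreme point of the vertex figure is the direction of an edge of `Δ` at `v`, hence a
  -- nonnegative multiple of a weight.
  have claim : ∀ y ∈ (convexHull ℝ B).extremePoints ℝ, 0 ≤ c.C i y := by
    intro y hy
    have hyB := extremePoints_convexHull_subset hy
    obtain ⟨s₀, hs₀, rfl⟩ := hyB
    have hs₀Δ := hSΔ hs₀.1
    have hs₀v : s₀ ≠ v := hs₀.2
    have hny : b s₀ ∉ convexHull ℝ (B \ {b s₀}) := fun hmem =>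
      ((convex_convexHull ℝ B).mem_extremePoints_iff_mem_sdiff_convexHull_sdiff.mp hy).2
        (convexHull_mono (Set.sdiff_subset_sdiff_left (subset_convexHull ℝ B)) hmem)
    obtain ⟨m, u, hmu, hmB⟩ := geometric_hahn_banach_point_closed (convex_convexHull ℝ _)
      ((hBfin.subset Set.sdiff_subset).isClosed_convexHull ℝ) hny
    -- As `l` is `-1` on all these directions, `m'` vanishes on `b s₀` and is positive on the
    -- others. So the face where `m'` is minimal lies on the ray from `v` through `s₀` and is an
    -- edge.
    let m' : StrongDual ℝ (Fin n → ℝ) := m + m (b s₀) • l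
    have hm' : ∀ s ∈ Δ, s ≠ v → m' s - m' v = (l v - l s) * (m (b s) - m (b s₀)) := by
      intro s hs hsv
      rw [← map_sub, hb s hs hsv, map_smul, smul_eq_mul]
      simp only [m', add_apply, smul_apply, smul_eq_mul, hlb s hs hsv]
      ring
    have hpos : ∀ s ∈ Δ.extremePoints ℝ, s ≠ v → b s ≠ b s₀ → m (b s₀) < m (b s) := by
      intro s hs hsv hne
      exact hmu.trans (hmB _ (subset_convexHull ℝ _ ⟨⟨s, ⟨hs, hsv⟩, rfl⟩, hne⟩))
    have hge : ∀ s ∈ Δ.extremePoints ℝ, m' v ≤ m' s := by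
      intro s hs
      by_cases hsv : s = v
      · rw [hsv]
      · have h1 := hm' s (hSΔ hs) hsv
        have h2 := hlt s (hSΔ hs) hsv
        have h3 : 0 ≤ m (b s) - m (b s₀) := by
          by_cases hbs : b s = b s₀
          · rw [hbs]; simp
          · linarith [hpos s hs hsv hbs]
        have := mul_nonneg (by linarith : 0 ≤ l v - l s) h3
        linarith
    have hgeΔ : ∀ x ∈ Δ, m' v ≤ m' x := by
      rw [← hS]
      intro x hx
      have := convexHull_le_of_forall_le (S := Δ.extremePoints ℝ) (c := - m' v)
        (((-m') : StrongDual ℝ (Fin n → ℝ)) : (Fin n → ℝ) →ₗ[ℝ] ℝ)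
        (fun s hs => by simpa using hge s hs) x hx
      simpa using this
    have he : IsExposed ℝ Δ ((-m').toExposed Δ) := ContinuousLinearMap.toExposed.isExposed
    have hve : v ∈ (-m').toExposed Δ := ⟨hvΔ, fun y hy => by simpa using hgeΔ y hy⟩
    have hs₀e : s₀ ∈ (-m').toExposed Δ := ⟨hs₀Δ, fun y hy => by
      have := hm' s₀ hs₀Δ hs₀v
      have := hgeΔ y hy
      simp only [neg_apply, neg_le_neg_iff]
      linarith⟩
    have hray : ∀ x ∈ (-m').toExposed Δ, ∃ t : ℝ, 0 ≤ t ∧ x = v + t • b s₀ := by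
      rw [← h.convexHull_extremePoints_face he]
      refine convexHull_min (t := {x | ∃ t : ℝ, 0 ≤ t ∧ x = v + t • b s₀}) ?_ ?_
      · intro s hs
        have hsΔ := he.isExtreme.extremePoints_subset_extremePoints hs
        by_cases hsv : s = v
        · exact ⟨0, le_rfl, by simp [hsv]⟩
        have hlts := hlt s (hSΔ hsΔ) hsv
        by_cases hbs : b s = b s₀
        · exact ⟨l v - l s, by linarith, by rw [← hbs, ← hb s (hSΔ hsΔ) hsv]; simp⟩
        · have h1 := hm' s (hSΔ hsΔ) hsv
          have h2 := mul_pos (by linarith : 0 < l v - l s) (sub_pos.mpr (hpos s hsΔ hsv hbs))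
          have h3 : m' s ≤ m' v := by simpa using hs.1.2 v hvΔ
          linarith
      · rintro _ ⟨t, ht, rfl⟩ _ ⟨t', ht', rfl⟩ p q hp hq hpq
        refine ⟨p * t + q * t', by positivity, ?_⟩
        obtain rfl : p = 1 - q := by linarith
        module
    have hb0 : b s₀ ≠ 0 := fun e => by
      have := hb s₀ hs₀Δ hs₀v
      rw [e, smul_zero, sub_eq_zero] at this
      exact hs₀v this
    have hrank : Module.finrank ℝ (vectorSpan ℝ ((-m').toExposed Δ)) = 1 := by
      rw [vectorSpan_eq_of_mem hve (T := ℝ ∙ b s₀), finrank_span_singleton hb0]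
      · intro x hx
        obtain ⟨t, -, rfl⟩ := hray x hx
        rw [add_sub_cancel_left]
        exact Submodule.smul_mem _ _ (Submodule.mem_span_singleton_self _)
      · rw [Submodule.span_singleton_le_iff_mem]
        exact Submodule.smul_mem _ _ (Submodule.subset_span ⟨s₀, hs₀e, rfl⟩)
    obtain ⟨j, hj⟩ := c.edge.surjective ⟨_, ⟨⟨v, hve⟩, he, hrank⟩, hve⟩
    obtain ⟨t, ht, hst⟩ := c.edge_subset j (by rw [hj]; exact hs₀e)
    have : b s₀ = ((l v - l s₀)⁻¹ * t) • realVec (c.w j) := by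
      simp only [b]
      rw [hst, add_sub_cancel_left, smul_smul]
      rfl
    rw [this, map_smul, C_w, smul_eq_mul]
    have : 0 ≤ (l v - l s₀)⁻¹ := inv_nonneg.mpr (by linarith [hlt s₀ hs₀Δ hs₀v])
    split <;> simp; positivity
  have hB : ∀ y ∈ convexHull ℝ B, 0 ≤ c.C i y := by
    rw [← hA]
    intro y hy
    have := convexHull_le_of_forall_le (c := 0)
      (((- c.C i) : StrongDual ℝ (Fin n → ℝ)) : (Fin n → ℝ) →ₗ[ℝ] ℝ)
      (fun s hs => by simpa using claim s hs) y hy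
    simpa using this
  have hSi : ∀ s ∈ Δ.extremePoints ℝ, c.C i v ≤ c.C i s := by
    intro s hs
    by_cases hsv : s = v
    · rw [hsv]
    · rw [← sub_nonneg, ← map_sub, hb s (hSΔ hs) hsv, map_smul, smul_eq_mul]
      exact mul_nonneg (by linarith [hlt s (hSΔ hs) hsv])
        (hB _ (subset_convexHull ℝ _ ⟨s, ⟨hs, hsv⟩, rfl⟩))
  rw [← hS] at hx
  have := convexHull_le_of_forall_le (S := Δ.extremePoints ℝ) (c := - c.C i v)
    (((- c.C i) : StrongDual ℝ (Fin n → ℝ)) : (Fin n → ℝ) →ₗ[ℝ] ℝ)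
    (fun s hs => by simpa using hSi s hs) x hx
  rw [map_sub]
  simpa using this

variable (c : Chart Δ v)

theorem edge_mem_faces (i : Fin n) : (c.edge i : Set (Fin n → ℝ)) ∈ faces Δ 1 := (c.edge i).2.1

theorem mem_edge (i : Fin n) : v ∈ (c.edge i : Set (Fin n → ℝ)) := (c.edge i).2.2

theorem exists_mem_edge (i : Fin n) :
    ∃ t : ℝ, 0 < t ∧ v + t • realVec (c.w i) ∈ (c.edge i : Set (Fin n → ℝ)) := by
  by_contra! hcon
  have hsub : (c.edge i : Set (Fin n → ℝ)) ⊆ {v} := by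
    intro x hx
    obtain ⟨t, ht, rfl⟩ := mem_ray.mp (c.edge_subset i hx)
    rcases ht.eq_or_lt with rfl | ht
    · simp
    · exact absurd hx (hcon t ht)
  have h1 := (c.edge_mem_faces i).2.2
  rw [Set.Subset.antisymm hsub (Set.singleton_subset_iff.mpr (c.mem_edge i)),
    vectorSpan_singleton, finrank_bot] at h1
  exact zero_ne_one h1

/-- The face of `Δ` at `v` spanned by the edges with index in `I`. -/
def face (I : Finset (Fin n)) : Set (Fin n → ℝ) := {x | x ∈ Δ ∧ ∀ i ∉ I, c.C i (x - v) = 0}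

theorem face_mono {I J : Finset (Fin n)} (h : I ⊆ J) : c.face I ⊆ c.face J :=
  fun _ hx => ⟨hx.1, fun i hi => hx.2 i fun hI => hi (h hI)⟩

theorem mem_face (hv : v ∈ vertices Δ) (I : Finset (Fin n)) : v ∈ c.face I :=
  ⟨hv.2.1.subset rfl, fun i _ => by simp⟩

/-- The sum of the coordinates outside `I` is nonnegative on `Δ` and vanishes exactly on this face.
-/
theorem isExposed_face (h : IsPolytope Δ) (hv : v ∈ vertices Δ) (I : Finset (Fin n)) :
    IsExposed ℝ Δ (c.face I) := by
  intro _
  refine ⟨-∑ i ∈ Iᶜ, c.C i, ?_⟩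
  have hs : ∀ x, (-∑ i ∈ Iᶜ, c.C i) x = - (∑ i ∈ Iᶜ, c.C i (x - v)) - ∑ i ∈ Iᶜ, c.C i v := by
    intro x; simp
  have h0 : ∀ x ∈ Δ, 0 ≤ ∑ i ∈ Iᶜ, c.C i (x - v) := fun x hx =>
    Finset.sum_nonneg fun i _ => c.C_nonneg h hv hx i
  ext x
  constructor
  · rintro ⟨hx, hI⟩
    refine ⟨hx, fun y hy => ?_⟩
    have : ∑ i ∈ Iᶜ, c.C i (x - v) = 0 :=
      Finset.sum_eq_zero fun i hi => hI i (by simpa using hi)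
    rw [hs, hs, this]
    linarith [h0 y hy]
  · rintro ⟨hx, hmax⟩
    refine ⟨hx, fun i hi => ?_⟩
    have h1 := hmax v (hv.2.1.subset rfl)
    rw [hs, hs] at h1
    have h2 : ∑ i ∈ Iᶜ, c.C i (x - v) = 0 :=
      le_antisymm (by simp only [sub_self, map_zero, Finset.sum_const_zero] at h1; linarith)
        (h0 x hx)
    exact (Finset.sum_eq_zero_iff_of_nonneg fun i _ => c.C_nonneg h hv hx i).mp h2 i
      (by simpa using hi)

open Classical in
/-- Every face through a vertex is spanned by the edges it contains. -/
theorem eq_face (h : IsPolytope Δ) (hv : v ∈ vertices Δ) (hF : IsExposed ℝ Δ F) (hvF : v ∈ F) :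
    F = c.face (Finset.univ.filter fun i => (c.edge i : Set (Fin n → ℝ)) ⊆ F) := by
  obtain ⟨l, hl⟩ := hF ⟨v, hvF⟩
  have lmax : ∀ x ∈ Δ, l x ≤ l v := by rw [hl] at hvF; exact hvF.2
  have memF : ∀ x, x ∈ F ↔ x ∈ Δ ∧ l x = l v := by
    intro x
    constructor
    · intro hx
      refine ⟨hF.subset hx, le_antisymm (lmax x (hF.subset hx)) ?_⟩
      rw [hl] at hx; exact hx.2 v (hF.subset hvF)
    · rintro ⟨hx, e⟩
      rw [hl]; exact ⟨hx, fun y hy => e ▸ lmax y hy⟩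
  have hw : ∀ i, l (realVec (c.w i)) ≤ 0 := by
    intro i
    obtain ⟨t, ht, hm⟩ := c.exists_mem_edge i
    have := lmax _ ((c.edge_mem_faces i).2.1.subset hm)
    rw [map_add, map_smul, smul_eq_mul] at this
    by_contra! hneg
    have := mul_pos ht hneg
    linarith
  have hlx : ∀ x, l x = l v + ∑ i, c.C i (x - v) * l (realVec (c.w i)) := by
    intro x
    have : l (x - v) = ∑ i, c.C i (x - v) * l (realVec (c.w i)) := by
      conv_lhs => rw [← c.sum_C (x - v), map_sum]
      simp
    rw [← this, map_sub]; ring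
  have hedge : ∀ i, (c.edge i : Set (Fin n → ℝ)) ⊆ F ↔ l (realVec (c.w i)) = 0 := by
    intro i
    constructor
    · intro hi
      obtain ⟨t, ht, hm⟩ := c.exists_mem_edge i
      have := ((memF _).mp (hi hm)).2
      rw [map_add, map_smul, smul_eq_mul] at this
      have : t * l (realVec (c.w i)) = 0 := by linarith
      exact (mul_eq_zero.mp this).resolve_left ht.ne'
    · intro hi x hx
      refine (memF x).mpr ⟨(c.edge_mem_faces i).2.1.subset hx, ?_⟩
      obtain ⟨t, ht, rfl⟩ := mem_ray.mp (c.edge_subset i hx)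
      rw [map_add, map_smul, hi, smul_zero, add_zero]
  ext x
  rw [memF, face]
  refine and_congr_right fun hx => ?_
  -- `l v - l x` is a sum of nonnegative terms, so `x` lies in `F` exactly when its coordinates
  -- vanish along every edge on which `l` is not constant.
  have hterm : ∀ i ∈ Finset.univ, 0 ≤ - (c.C i (x - v) * l (realVec (c.w i))) := fun i _ => by
    rw [← mul_neg]
    exact mul_nonneg (c.C_nonneg h hv hx i) (by linarith [hw i])
  have : l x = l v ↔ ∑ i, - (c.C i (x - v) * l (realVec (c.w i))) = 0 := by
    rw [hlx x, Finset.sum_neg_distrib]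
    constructor <;> intro h <;> linarith
  rw [this, Finset.sum_eq_zero_iff_of_nonneg hterm]
  refine forall_congr' fun i => ?_
  simp only [Finset.mem_univ, true_implies, neg_eq_zero, mul_eq_zero, Finset.mem_filter, true_and,
    hedge]
  tauto

theorem sub_mem_span_of_mem_face {I : Finset (Fin n)} {x : Fin n → ℝ} (hx : x ∈ c.face I) :
    x - v = ∑ i ∈ I, c.C i (x - v) • realVec (c.w i) := by
  conv_lhs => rw [← c.sum_C (x - v)]
  refine (Finset.sum_subset (Finset.subset_univ I) fun i _ hi => ?_).symm
  rw [hx.2 i hi, zero_smul]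

theorem linearIndependent_w : LinearIndependent ℝ fun i => realVec (c.w i) := by
  rw [Fintype.linearIndependent_iff]
  intro g hg i
  have := congrArg (c.C i) hg
  simpa [C_w] using this

theorem exists_mem_face {I : Finset (Fin n)} {i : Fin n} (hi : i ∈ I) :
    ∃ t : ℝ, 0 < t ∧ v + t • realVec (c.w i) ∈ c.face I := by
  obtain ⟨t, ht, hm⟩ := c.exists_mem_edge i
  refine ⟨t, ht, (c.edge_mem_faces i).2.1.subset hm, fun j hj => ?_⟩
  rw [add_sub_cancel_left, map_smul, C_w, if_neg (fun e : j = i => hj (e ▸ hi)), smul_zero]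

theorem vectorSpan_face (hv : v ∈ vertices Δ) (I : Finset (Fin n)) :
    vectorSpan ℝ (c.face I) = Submodule.span ℝ ((fun i => realVec (c.w i)) '' I) := by
  refine vectorSpan_eq_of_mem (c.mem_face hv I) (fun x hx => ?_) ?_
  · rw [c.sub_mem_span_of_mem_face hx]
    exact Submodule.sum_mem _ fun i hi =>
      Submodule.smul_mem _ _ (Submodule.subset_span ⟨i, hi, rfl⟩)
  · rw [Submodule.span_le]
    rintro _ ⟨i, hi, rfl⟩
    obtain ⟨t, ht, hm⟩ := c.exists_mem_face hi
    have h1 : t • realVec (c.w i) ∈ Submodule.span ℝ ((fun x => x - v) '' c.face I) :=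
      Submodule.subset_span ⟨_, hm, by simp⟩
    have h2 := Submodule.smul_mem _ t⁻¹ h1
    rwa [smul_smul, inv_mul_cancel₀ ht.ne', one_smul] at h2

theorem finrank_face (hv : v ∈ vertices Δ) (I : Finset (Fin n)) :
    Module.finrank ℝ (vectorSpan ℝ (c.face I)) = I.card := by
  rw [c.vectorSpan_face hv, Set.image_eq_range, finrank_span_eq_card
    (b := fun i : (I : Set (Fin n)) => realVec (c.w i))
    (c.linearIndependent_w.comp _ Subtype.val_injective)]
  simp

theorem face_mem_faces (h : IsPolytope Δ) (hv : v ∈ vertices Δ) (I : Finset (Fin n)) :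
    c.face I ∈ faces Δ I.card :=
  ⟨⟨v, c.mem_face hv I⟩, c.isExposed_face h hv I, c.finrank_face hv I⟩

/-- By `eq_face` the edge is spanned by the edges it contains; its dimension leaves room for one
only, which is itself. -/
theorem edge_eq_face (h : IsPolytope Δ) (hv : v ∈ vertices Δ) (i : Fin n) :
    (c.edge i : Set (Fin n → ℝ)) = c.face {i} := by
  classical
  have e := c.eq_face h hv (c.edge_mem_faces i).2.1 (c.mem_edge i)
  have hc := (c.edge_mem_faces i).2.2
  rw [e, c.finrank_face hv, Finset.card_eq_one] at hc
  obtain ⟨j, hj⟩ := hc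
  have hi : i ∈ ({j} : Finset (Fin n)) := by rw [← hj]; simp
  rw [Finset.mem_singleton] at hi
  rw [e, hj, hi]

theorem edge_subset_face_iff (h : IsPolytope Δ) (hv : v ∈ vertices Δ) {i : Fin n}
    {I : Finset (Fin n)} : (c.edge i : Set (Fin n → ℝ)) ⊆ c.face I ↔ i ∈ I := by
  constructor
  · intro hs
    by_contra hi
    obtain ⟨t, ht, hm⟩ := c.exists_mem_edge i
    have := (hs hm).2 i hi
    rw [add_sub_cancel_left, map_smul, C_w, if_pos rfl, smul_eq_mul, mul_one] at this
    exact ht.ne' this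
  · intro hi
    rw [c.edge_eq_face h hv]
    exact c.face_mono (Finset.singleton_subset_iff.mpr hi)

/-- A `2`-face containing an edge at `v` is spanned by it and another edge at `v`. -/
theorem exists_eq_face_pair (h : IsPolytope Δ) (hv : v ∈ vertices Δ) (hF : F ∈ faces Δ 2)
    {i : Fin n} (hi : (c.edge i : Set (Fin n → ℝ)) ⊆ F) : ∃ j, j ≠ i ∧ F = c.face {i, j} := by
  classical
  have e := c.eq_face h hv hF.2.1 (hi (c.mem_edge i))
  have hc := hF.2.2
  rw [e, c.finrank_face hv, Finset.card_eq_two] at hc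
  obtain ⟨a, b, hab, hj⟩ := hc
  have hi' : i ∈ ({a, b} : Finset (Fin n)) := by rw [← hj]; simp [hi]
  rw [hj] at e
  rw [Finset.mem_insert, Finset.mem_singleton] at hi'
  rcases hi' with rfl | rfl
  · exact ⟨b, hab.symm, e⟩
  · exact ⟨a, hab, by rw [e, Finset.pair_comm]⟩

theorem exists_edge_eq {e : Set (Fin n → ℝ)} (he : e ∈ faces Δ 1) (hve : v ∈ e) :
    ∃ i, (c.edge i : Set (Fin n → ℝ)) = e := by
  obtain ⟨i, hi⟩ := c.edge.surjective ⟨e, he, hve⟩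
  exact ⟨i, by rw [hi]⟩

theorem edge_injective {i j : Fin n}
    (h : (c.edge i : Set (Fin n → ℝ)) = c.edge j) : i = j :=
  c.edge.injective (Subtype.ext h)

end Chart

/-! ### Weights and end points of edges -/

variable {Δ F : Set (Fin n → ℝ)}

/-- `w` is the weight at `v` along the edge `e`. -/
def IsWeight (Δ : Set (Fin n → ℝ)) (v : Fin n → ℝ) (e : Set (Fin n → ℝ)) (w : Fin n → ℤ) : Prop :=
  ∃ c : Chart Δ v, ∃ i, (c.edge i : Set (Fin n → ℝ)) = e ∧ c.w i = w

/-- Weights are primitive: the dual bases express two parallel ones as integral multiples of each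
other, and the two factors have product `1`. -/
theorem Chart.w_eq_or_neg {u v : Fin n → ℝ} (c : Chart Δ u) (c' : Chart Δ v) {i j : Fin n}
    {s t : ℝ} (ht : t ≠ 0) (h : t • realVec (c.w i) = s • realVec (c'.w j)) :
    (s = t ∧ c'.w j = c.w i) ∨ (s = -t ∧ c'.w j = - c.w i) := by
  have h1 := congrArg (c.C i) h
  have h2 := congrArg (c'.C j) h
  rw [map_smul, map_smul, C_w, if_pos rfl, C_realVec, smul_eq_mul, smul_eq_mul, mul_one] at h1
  rw [map_smul, map_smul, C_w, if_pos rfl, C_realVec, smul_eq_mul, smul_eq_mul, mul_one] at h2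
  have hk : (c.N i ⬝ᵥ c'.w j) * (c'.N j ⬝ᵥ c.w i) = 1 := by
    have : t * (((c.N i ⬝ᵥ c'.w j) * (c'.N j ⬝ᵥ c.w i) : ℤ) : ℝ) = t * 1 := by
      push_cast
      linear_combination (-1 : ℝ) * h1 + (c.N i ⬝ᵥ c'.w j : ℤ) * h2
    exact_mod_cast mul_left_cancel₀ ht this
  rcases Int.mul_eq_one_iff_eq_one_or_neg_one.mp hk with ⟨h3, -⟩ | ⟨h3, -⟩
  · rw [h3] at h1
    have hst : s = t := by rw [h1]; simp
    refine Or.inl ⟨hst, realVec_injective ?_⟩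
    rw [hst] at h
    exact (smul_right_injective _ ht h).symm
  · rw [h3] at h1
    have hst : s = -t := by rw [h1]; simp
    refine Or.inr ⟨hst, realVec_injective ?_⟩
    rw [hst, neg_smul, ← smul_neg] at h
    rw [realVec_neg, smul_right_injective _ ht h, neg_neg]

theorem Chart.w_eq_of_edge_subset {v : Fin n → ℝ} (c c' : Chart Δ v) {i j : Fin n}
    (h : (c.edge i : Set (Fin n → ℝ)) ⊆ ray v (c'.w j)) : c'.w j = c.w i := by
  obtain ⟨t, ht, hm⟩ := c.exists_mem_edge i
  obtain ⟨s, hs, hst⟩ := mem_ray.mp (h hm)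
  rcases c.w_eq_or_neg c' ht.ne' (add_left_cancel hst) with h1 | h1
  · exact h1.2
  · linarith [h1.1]

theorem Chart.w_injective {v : Fin n → ℝ} (c : Chart Δ v) : Function.Injective c.w := by
  intro i j hij
  by_contra hne
  have h := c.dual i i
  rw [hij, c.dual, if_neg hne, if_pos rfl] at h
  exact zero_ne_one h

theorem IsWeight.unique {v : Fin n → ℝ} {e : Set (Fin n → ℝ)} {w w' : Fin n → ℤ}
    (h : IsWeight Δ v e w) (h' : IsWeight Δ v e w') : w = w' := by
  obtain ⟨c, i, hi, rfl⟩ := h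
  obtain ⟨c', j, hj, rfl⟩ := h'
  exact (c.w_eq_of_edge_subset c' (by rw [hi, ← hj]; exact c'.edge_subset j)).symm

theorem Chart.edge_eq_of_subset {v : Fin n → ℝ} (c : Chart Δ v) {e : Set (Fin n → ℝ)}
    (he : e ∈ faces Δ 1) (hv : v ∈ e) {i : Fin n} (h : e ⊆ ray v (c.w i)) :
    (c.edge i : Set (Fin n → ℝ)) = e := by
  obtain ⟨j, rfl⟩ := c.exists_edge_eq he hv
  rw [c.w_injective (c.w_eq_of_edge_subset c h)]

theorem IsDelzant.isPolytope (hΔ : IsDelzant Δ) : IsPolytope Δ := by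
  obtain ⟨⟨S, -, hS⟩, -⟩ := hΔ.polytope
  exact ⟨S, hS⟩

theorem IsDelzant.exists_chart (hΔ : IsDelzant Δ) {v : Fin n → ℝ} (hv : v ∈ vertices Δ) :
    Nonempty (Chart Δ v) := by
  obtain ⟨w, hw⟩ := hΔ.smooth v hv
  exact ⟨hw.exists_chart.choose⟩

theorem IsDelzant.exists_isWeight (hΔ : IsDelzant Δ) {v : Fin n → ℝ} (hv : v ∈ vertices Δ)
    {e : Set (Fin n → ℝ)} (he : e ∈ faces Δ 1) (hve : v ∈ e) : ∃ w, IsWeight Δ v e w := by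
  obtain ⟨c⟩ := hΔ.exists_chart hv
  obtain ⟨i, hi⟩ := c.exists_edge_eq he hve
  exact ⟨c.w i, c, i, hi, rfl⟩

/-- A vertex is not strictly between two points of the polytope. -/
theorem eq_of_mem_openSegment {u v x : Fin n → ℝ} (hv : v ∈ vertices Δ) (hu : u ∈ Δ) (hx : x ∈ Δ)
    (h : v ∈ openSegment ℝ u x) : u = v := by
  have := hv.2.1.isExtreme
  rw [isExtreme_singleton] at this
  exact this.2 hu hx h

theorem Chart.vertex_mem_edge {u v : Fin n → ℝ} (c : Chart Δ u) {i : Fin n}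
    (hve : v ∈ (c.edge i : Set (Fin n → ℝ))) (hne : v ≠ u) :
    ∃ t : ℝ, 0 < t ∧ v = u + t • realVec (c.w i) := by
  obtain ⟨t, ht, rfl⟩ := mem_ray.mp (c.edge_subset i hve)
  refine ⟨t, ht.lt_of_ne ?_, rfl⟩
  rintro rfl
  simp at hne

/-- An edge has exactly two vertices. -/
theorem exists_other_vertex (h : IsPolytope Δ) {u : Fin n → ℝ} (c : Chart Δ u)
    {e : Set (Fin n → ℝ)} (he : e ∈ faces Δ 1) (hue : u ∈ e) :
    ∃ v ∈ vertices Δ, v ∈ e ∧ v ≠ u ∧ ∀ v' ∈ vertices Δ, v' ∈ e → v' = u ∨ v' = v := by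
  obtain ⟨i, rfl⟩ := c.exists_edge_eq he hue
  obtain ⟨v, hve, hv, hmin⟩ := h.exists_vertex_forall_le he.2.1 he.1 (-c.C i)
  have hmax : ∀ x ∈ (c.edge i : Set (Fin n → ℝ)), c.C i x ≤ c.C i v := fun x hx => by
    simpa using hmin x hx
  obtain ⟨t, ht, hm⟩ := c.exists_mem_edge i
  have hvu : v ≠ u := by
    rintro rfl
    have := hmax _ hm
    rw [map_add, map_smul, Chart.C_w, if_pos rfl, smul_eq_mul] at this
    linarith
  refine ⟨v, hv, hve, hvu, fun v' hv' hve' => ?_⟩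
  by_contra! hcon
  obtain ⟨t, ht, rfl⟩ := c.vertex_mem_edge hve hvu
  obtain ⟨s, hs, rfl⟩ := c.vertex_mem_edge hve' hcon.1
  have hst : s ≤ t := by
    have := hmax _ hve'
    simpa [Chart.C_w] using this
  have hst' : s < t := hst.lt_of_ne fun e => hcon.2 (by rw [e])
  -- A third vertex would lie strictly between `u` and the point of the edge farthest from `u`.
  refine hcon.1 (eq_of_mem_openSegment hv' (he.2.1.subset hue) (he.2.1.subset hve) ?_).symm
  refine ⟨1 - s / t, s / t, by rw [sub_pos, div_lt_one ht]; exact hst', by positivity, by ring, ?_⟩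
  have : s = s / t * t := by field_simp
  conv_rhs => rw [this]
  module

/-! ### Corners of two-faces and transitions between them -/

/-- `e` and `e'` are the edges of the `2`-face `F` at its vertex `v`, with weights `p` and `q`. -/
def IsCorner (Δ F : Set (Fin n → ℝ)) (v : Fin n → ℝ) (e e' : Set (Fin n → ℝ))
    (p q : Fin n → ℤ) : Prop :=
  v ∈ vertices Δ ∧ ∃ c : Chart Δ v, ∃ i j, i ≠ j ∧ F = c.face {i, j} ∧
    (c.edge i : Set (Fin n → ℝ)) = e ∧ (c.edge j : Set (Fin n → ℝ)) = e' ∧ c.w i = p ∧ c.w j = q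

theorem IsDelzant.isCorner (hΔ : IsDelzant Δ) (hF : F ∈ faces Δ 2) {v : Fin n → ℝ}
    (hv : v ∈ vertices Δ) {e e' : Set (Fin n → ℝ)} (he : e ∈ faces Δ 1) (he' : e' ∈ faces Δ 1)
    (hve : v ∈ e) (hve' : v ∈ e') (heF : e ⊆ F) (heF' : e' ⊆ F) (hne : e' ≠ e)
    {p q : Fin n → ℤ} (hp : IsWeight Δ v e p) (hq : IsWeight Δ v e' q) :
    IsCorner Δ F v e e' p q := by
  obtain ⟨c⟩ := hΔ.exists_chart hv
  obtain ⟨i, rfl⟩ := c.exists_edge_eq he hve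
  obtain ⟨j, rfl⟩ := c.exists_edge_eq he' hve'
  obtain ⟨k, hk, rfl⟩ := c.exists_eq_face_pair hΔ.isPolytope hv hF heF
  rw [c.edge_subset_face_iff hΔ.isPolytope hv] at heF'
  have hij : j ≠ i := fun h => hne (by rw [h])
  obtain rfl : j = k := by
    rw [Finset.mem_insert, Finset.mem_singleton] at heF'
    exact heF'.resolve_left hij
  exact ⟨hv, c, i, j, hij.symm, rfl, rfl, rfl, IsWeight.unique ⟨c, i, rfl, rfl⟩ hp,
    IsWeight.unique ⟨c, j, rfl, rfl⟩ hq⟩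

theorem IsDelzant.exists_other_edge (hΔ : IsDelzant Δ) (hF : F ∈ faces Δ 2) {v : Fin n → ℝ}
    (hv : v ∈ vertices Δ) {e : Set (Fin n → ℝ)} (he : e ∈ faces Δ 1) (hve : v ∈ e) (heF : e ⊆ F) :
    ∃ e' ∈ faces Δ 1, v ∈ e' ∧ e' ⊆ F ∧ e' ≠ e ∧
      ∀ e'' ∈ faces Δ 1, v ∈ e'' → e'' ⊆ F → e'' = e ∨ e'' = e' := by
  obtain ⟨c⟩ := hΔ.exists_chart hv
  obtain ⟨i, rfl⟩ := c.exists_edge_eq he hve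
  obtain ⟨k, hk, rfl⟩ := c.exists_eq_face_pair hΔ.isPolytope hv hF heF
  refine ⟨c.edge k, c.edge_mem_faces k, c.mem_edge k, ?_, fun h => hk (c.edge_injective h), ?_⟩
  · rw [c.edge_subset_face_iff hΔ.isPolytope hv]; simp
  · intro e'' he'' hve'' hs
    obtain ⟨j, rfl⟩ := c.exists_edge_eq he'' hve''
    rw [c.edge_subset_face_iff hΔ.isPolytope hv, Finset.mem_insert, Finset.mem_singleton] at hs
    rcases hs with rfl | rfl
    · exact Or.inl rfl
    · exact Or.inr rfl

theorem IsDelzant.exists_edge_at (hΔ : IsDelzant Δ) (hF : F ∈ faces Δ 2) {v : Fin n → ℝ}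
    (hv : v ∈ vertices Δ) (hvF : v ∈ F) : ∃ e ∈ faces Δ 1, v ∈ e ∧ e ⊆ F := by
  classical
  obtain ⟨c⟩ := hΔ.exists_chart hv
  have e := c.eq_face hΔ.isPolytope hv hF.2.1 hvF
  have hc := hF.2.2
  rw [e, c.finrank_face hv] at hc
  obtain ⟨i, hi⟩ := Finset.card_pos.mp (by omega : 0 < (Finset.univ.filter fun i =>
    (c.edge i : Set (Fin n → ℝ)) ⊆ F).card)
  exact ⟨c.edge i, c.edge_mem_faces i, c.mem_edge i, (Finset.mem_filter.mp hi).2⟩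

/-- The two weights extend to a lattice basis, so they generate all lattice vectors in the plane of
the face, with integral coefficients. -/
theorem Chart.eq_comb_of_mem_vectorSpan {v : Fin n → ℝ} (c : Chart Δ v) (hv : v ∈ vertices Δ)
    {i j : Fin n} (hij : i ≠ j) {x : Fin n → ℤ} (hx : realVec x ∈ vectorSpan ℝ (c.face {i, j})) :
    x = (c.N i ⬝ᵥ x) • c.w i + (c.N j ⬝ᵥ x) • c.w j := by
  have h0 : ∀ k ∉ ({i, j} : Finset (Fin n)), c.N k ⬝ᵥ x = 0 := by
    intro k hk
    have : vectorSpan ℝ (c.face {i, j}) ≤ LinearMap.ker (c.C k : (Fin n → ℝ) →ₗ[ℝ] ℝ) := by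
      rw [c.vectorSpan_face hv, Submodule.span_le]
      rintro _ ⟨l, hl, rfl⟩
      have : k ≠ l := fun e => hk (e ▸ hl)
      simp [C_w, this]
    have h1 : c.C k (realVec x) = 0 := this hx
    rw [C_realVec] at h1
    exact_mod_cast h1
  conv_lhs => rw [← c.sum_dual x]
  rw [← Finset.sum_pair hij (f := fun k => (c.N k ⬝ᵥ x) • c.w k)]
  refine (Finset.sum_subset (Finset.subset_univ _) fun k _ hk => ?_).symm
  rw [h0 k hk, zero_smul]

theorem Chart.w_mem_vectorSpan {v : Fin n → ℝ} (c : Chart Δ v) (hv : v ∈ vertices Δ)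
    {I : Finset (Fin n)} {i : Fin n} (hi : i ∈ I) :
    realVec (c.w i) ∈ vectorSpan ℝ (c.face I) := by
  rw [c.vectorSpan_face hv]
  exact Submodule.subset_span ⟨i, hi, rfl⟩

/-- The weights of a `2`-face at the two ends of an edge. -/
theorem IsCorner.exists_contribution (h : IsPolytope Δ) {u v : Fin n → ℝ}
    {e e₁ e₂ : Set (Fin n → ℝ)} {p q p' q' : Fin n → ℤ} (hu : IsCorner Δ F u e e₁ p q)
    (hv : IsCorner Δ F v e e₂ p' q') (huv : u ≠ v) : p' = -p ∧ ∃ a : ℤ, q - q' = a • p := by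
  obtain ⟨hu, c, i, j, hij, hF, he, -, rfl, rfl⟩ := hu
  obtain ⟨hv, c', i', j', hij', hF', he', -, rfl, rfl⟩ := hv
  have hdir : ∀ {u v : Fin n → ℝ} (c : Chart Δ u) (c' : Chart Δ v) {i i' : Fin n},
      (c.edge i : Set (Fin n → ℝ)) = c'.edge i' → u ≠ v →
      (∃ t : ℝ, v = u + t • realVec (c.w i)) ∧ c'.w i' = - c.w i := by
    intro u v c c' i i' hee huv
    obtain ⟨t, ht, hvt⟩ := c.vertex_mem_edge (hee ▸ c'.mem_edge i') huv.symm
    obtain ⟨s, hs, hus⟩ := c'.vertex_mem_edge (hee ▸ c.mem_edge i) huv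
    refine ⟨⟨t, hvt⟩, ?_⟩
    have : t • realVec (c.w i) = (-s) • realVec (c'.w i') := by
      have h1 : v = v + s • realVec (c'.w i') + t • realVec (c.w i) := by rw [← hus]; exact hvt
      have h2 : s • realVec (c'.w i') + t • realVec (c.w i) = 0 := by
        rw [add_assoc] at h1
        exact left_eq_add.mp h1
      rw [neg_smul]
      exact eq_neg_of_add_eq_zero_right h2
    rcases c.w_eq_or_neg c' ht.ne' this with h1 | h1
    · linarith [h1.1]
    · exact h1.2
  -- The coefficient `b` is nonnegative because `F` lies on one side of the edge: along it the
  -- coordinate `c.C j` relative to `u` vanishes.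
  have half : ∀ {u v : Fin n → ℝ} (c : Chart Δ u) (c' : Chart Δ v) {i j i' j' : Fin n}, u ≠ v →
      u ∈ vertices Δ → v ∈ vertices Δ → i ≠ j → i' ≠ j' → F = c.face {i, j} →
      F = c'.face {i', j'} → (c.edge i : Set (Fin n → ℝ)) = c'.edge i' →
      ∃ a b : ℤ, 0 ≤ b ∧ c'.w j' = a • c.w i + b • c.w j := by
    intro u v c c' i j i' j' huv hu hv hij hij' hF hF' hee
    refine ⟨_, _, ?_, c.eq_comb_of_mem_vectorSpan hu hij (x := c'.w j') ?_⟩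
    · obtain ⟨⟨s, hs⟩, -⟩ := hdir c c' hee huv
      obtain ⟨t, ht, hm⟩ := c'.exists_mem_face (I := {i', j'}) (i := j') (by simp)
      have := c.C_nonneg h hu hm.1 j
      have hsub : ∀ y, v + t • y - u = s • realVec (c.w i) + t • y := fun y => by rw [hs]; abel
      rw [hsub, map_add, map_smul, map_smul, c.C_w, if_neg hij.symm, c.C_realVec, smul_zero,
        zero_add, smul_eq_mul] at this
      have := nonneg_of_mul_nonneg_right this ht
      exact_mod_cast this
    · rw [← hF, hF']
      exact c'.w_mem_vectorSpan hv (by simp)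
  obtain ⟨-, hneg⟩ := hdir c c' (he.trans he'.symm) huv
  obtain ⟨a, b, hb, h1⟩ := half c c' huv hu hv hij hij' hF hF' (he.trans he'.symm)
  obtain ⟨a', b', hb', h2⟩ := half c' c huv.symm hv hu hij' hij hF' hF (he'.trans he.symm)
  -- Modulo the direction of the edge, the two transitions are inverse to each other; nonnegativity
  -- then excludes `b = -1`.
  have hbb : b * b' = 1 := by
    have h3 := congrArg (fun x => c.N j ⬝ᵥ x) h2
    simp only [dotProduct_add, dotProduct_smul, hneg, h1, dotProduct_neg, c.dual, if_pos,
      if_neg hij.symm] at h3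
    simp at h3
    linarith
  have hb1 : b = 1 := by
    rcases Int.mul_eq_one_iff_eq_one_or_neg_one.mp hbb with h3 | h3 <;> omega
  refine ⟨hneg, -a, ?_⟩
  rw [h1, hb1]
  module

/-- Coordinates on the lattice of a `2`-face. -/
theorem IsCorner.exists_coordinates {v₀ : Fin n → ℝ} {e₀ e₀' : Set (Fin n → ℝ)}
    {p₀ q₀ : Fin n → ℤ} (h₀ : IsCorner Δ F v₀ e₀ e₀' p₀ q₀) : ∃ ξ η : Fin n → ℤ,
    ∀ v e e' p q, IsCorner Δ F v e e' p q → ((ξ ⬝ᵥ p) * (η ⬝ᵥ q) - (η ⬝ᵥ p) * (ξ ⬝ᵥ q)) ^ 2 = 1 := by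
  obtain ⟨hv₀, c₀, i₀, j₀, hij₀, hF₀, -, -, -, -⟩ := h₀
  refine ⟨c₀.N i₀, c₀.N j₀, ?_⟩
  rintro v e e' p q ⟨hv, c, i, j, hij, hF, -, -, rfl, rfl⟩
  have hi := c₀.eq_comb_of_mem_vectorSpan hv₀ hij₀ (x := c.w i)
    (by rw [← hF₀, hF]; exact c.w_mem_vectorSpan hv (by simp))
  have hj := c₀.eq_comb_of_mem_vectorSpan hv₀ hij₀ (x := c.w j)
    (by rw [← hF₀, hF]; exact c.w_mem_vectorSpan hv (by simp))
  have hi₀ := c.eq_comb_of_mem_vectorSpan hv hij (x := c₀.w i₀)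
    (by rw [← hF, hF₀]; exact c₀.w_mem_vectorSpan hv₀ (by simp))
  have hj₀ := c.eq_comb_of_mem_vectorSpan hv hij (x := c₀.w j₀)
    (by rw [← hF, hF₀]; exact c₀.w_mem_vectorSpan hv₀ (by simp))
  generalize c.N i ⬝ᵥ c₀.w i₀ = a at *
  generalize c.N j ⬝ᵥ c₀.w i₀ = b at *
  generalize c.N i ⬝ᵥ c₀.w j₀ = a' at *
  generalize c.N j ⬝ᵥ c₀.w j₀ = b' at *
  have d1 := congrArg (fun x => c₀.N i₀ ⬝ᵥ x) hi₀
  have d2 := congrArg (fun x => c₀.N j₀ ⬝ᵥ x) hi₀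
  have d3 := congrArg (fun x => c₀.N i₀ ⬝ᵥ x) hj₀
  have d4 := congrArg (fun x => c₀.N j₀ ⬝ᵥ x) hj₀
  simp only [dotProduct_add, dotProduct_smul, c₀.dual, if_neg hij₀, if_neg hij₀.symm, if_true,
    smul_eq_mul] at d1 d2 d3 d4
  generalize c₀.N i₀ ⬝ᵥ c.w i = A at *
  generalize c₀.N j₀ ⬝ᵥ c.w i = B at *
  generalize c₀.N i₀ ⬝ᵥ c.w j = A' at *
  generalize c₀.N j₀ ⬝ᵥ c.w j = B' at *
  -- The two integral transition matrices are inverse to each other.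
  have hdet : (A * B' - B * A') * (a * b' - b * a') = 1 := by
    linear_combination (-1 : ℤ) * d1 * (a' * B + b' * B') - d4 + d3 * (a * B + b * B')
  rcases Int.mul_eq_one_iff_eq_one_or_neg_one.mp hdet with h3 | h3 <;> rw [h3.1] <;> norm_num

/-- A functional positive on both edges of a corner is minimal on the face at that corner only. -/
theorem IsCorner.lt_of_pos (h : IsPolytope Δ) {v : Fin n → ℝ} {e e' : Set (Fin n → ℝ)}
    {p q : Fin n → ℤ} (hc : IsCorner Δ F v e e' p q) {ξ : Fin n → ℤ} (hp : 0 < ξ ⬝ᵥ p)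
    (hq : 0 < ξ ⬝ᵥ q) {y : Fin n → ℝ} (hy : y ∈ F) (hne : y ≠ v) :
    realDual ξ v < realDual ξ y := by
  obtain ⟨hv, c, i, j, hij, rfl, -, -, rfl, rfl⟩ := hc
  have hsub := c.sub_mem_span_of_mem_face hy
  rw [Finset.sum_pair hij] at hsub
  have h1 := congrArg (realDual ξ) hsub
  rw [map_sub, map_add, map_smul, map_smul, realDual_realVec, realDual_realVec, smul_eq_mul,
    smul_eq_mul] at h1
  have hi := c.C_nonneg h hv hy.1 i
  have hj := c.C_nonneg h hv hy.1 j
  have hp' : (0 : ℝ) < (ξ ⬝ᵥ c.w i : ℤ) := by exact_mod_cast hp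
  have hq' : (0 : ℝ) < (ξ ⬝ᵥ c.w j : ℤ) := by exact_mod_cast hq
  have m1 := mul_nonneg hi hp'.le
  have m2 := mul_nonneg hj hq'.le
  refine lt_of_le_of_ne (by linarith) fun heq => hne ?_
  have z1 : c.C i (y - v) = 0 :=
    (mul_eq_zero.mp (by linarith : c.C i (y - v) * (ξ ⬝ᵥ c.w i : ℤ) = 0)).resolve_right hp'.ne'
  have z2 : c.C j (y - v) = 0 :=
    (mul_eq_zero.mp (by linarith : c.C j (y - v) * (ξ ⬝ᵥ c.w j : ℤ) = 0)).resolve_right hq'.ne'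
  rw [z1, z2, zero_smul, zero_smul, add_zero, sub_eq_zero] at hsub
  exact hsub

theorem IsCorner.nonneg_of_forall_le {v : Fin n → ℝ} {e e' : Set (Fin n → ℝ)}
    {p q : Fin n → ℤ} (hc : IsCorner Δ F v e e' p q) {ξ : Fin n → ℤ}
    (hmin : ∀ y ∈ F, realDual ξ v ≤ realDual ξ y) : 0 ≤ ξ ⬝ᵥ p := by
  obtain ⟨hv, c, i, j, hij, rfl, -, -, rfl, rfl⟩ := hc
  obtain ⟨t, ht, hm⟩ := c.exists_mem_face (I := {i, j}) (i := i) (by simp)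
  have := hmin _ hm
  rw [map_add, map_smul, realDual_realVec, smul_eq_mul] at this
  have := nonneg_of_mul_nonneg_right (by linarith : 0 ≤ t * (ξ ⬝ᵥ c.w i : ℤ)) ht
  exact_mod_cast this

theorem IsPolytope.finite_vertices (h : IsPolytope Δ) : (vertices Δ).Finite :=
  (h.finite_faces 0).preimage (f := fun v => ({v} : Set (Fin n → ℝ)))
    Set.singleton_injective.injOn

theorem IsCorner.unique (h : IsPolytope Δ) {v : Fin n → ℝ} {e e₁ e₂ : Set (Fin n → ℝ)}
    {p₁ q₁ p₂ q₂ : Fin n → ℤ} (h₁ : IsCorner Δ F v e e₁ p₁ q₁) (h₂ : IsCorner Δ F v e e₂ p₂ q₂) :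
    p₁ = p₂ ∧ q₁ = q₂ := by
  obtain ⟨hv, c, i, j, hij, hF, he, rfl, rfl, rfl⟩ := h₁
  obtain ⟨-, c', i', j', hij', hF', he', rfl, rfl, rfl⟩ := h₂
  refine ⟨IsWeight.unique ⟨c, i, rfl, rfl⟩ ⟨c', i', he'.trans he.symm, rfl⟩, ?_⟩
  obtain ⟨k, hk⟩ := c.exists_edge_eq (c'.edge_mem_faces j') (c'.mem_edge j')
  have hkF : (c.edge k : Set (Fin n → ℝ)) ⊆ F := by
    rw [hk, hF', c'.edge_subset_face_iff h hv]; simp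
  rw [hF, c.edge_subset_face_iff h hv, Finset.mem_insert, Finset.mem_singleton] at hkF
  rcases hkF with rfl | rfl
  · exact absurd (c'.edge_injective (he'.trans (he.symm.trans hk))) hij'
  · exact IsWeight.unique ⟨c, k, rfl, rfl⟩ ⟨c', j', hk.symm, rfl⟩

/-- `a` is the normal contribution of the edge `e` in the direction of the `2`-face `F`. -/
def IsContribution (Δ F e : Set (Fin n → ℝ)) (a : ℤ) : Prop :=
  ∀ u v e₁ e₂ p q p' q', u ≠ v → IsCorner Δ F u e e₁ p q → IsCorner Δ F v e e₂ p' q' →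
    q - q' = a • p

theorem IsCorner.mem {v : Fin n → ℝ} {e e' : Set (Fin n → ℝ)} {p q : Fin n → ℤ}
    (h : IsCorner Δ F v e e' p q) : v ∈ vertices Δ ∧ v ∈ e := by
  obtain ⟨hv, c, i, j, -, -, rfl, -⟩ := h
  exact ⟨hv, c.mem_edge i⟩

theorem IsDelzant.exists_isCorner (hΔ : IsDelzant Δ) (hF : F ∈ faces Δ 2) {v : Fin n → ℝ}
    (hv : v ∈ vertices Δ) {e : Set (Fin n → ℝ)} (he : e ∈ faces Δ 1) (hve : v ∈ e) (heF : e ⊆ F) :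
    ∃ e' p q, IsCorner Δ F v e e' p q := by
  obtain ⟨e', he', hve', heF', hne, -⟩ := hΔ.exists_other_edge hF hv he hve heF
  obtain ⟨p, hp⟩ := hΔ.exists_isWeight hv he hve
  obtain ⟨q, hq⟩ := hΔ.exists_isWeight hv he' hve'
  exact ⟨e', p, q, hΔ.isCorner hF hv he he' hve hve' heF heF' hne hp hq⟩

theorem IsDelzant.exists_isContribution (hΔ : IsDelzant Δ) (hF : F ∈ faces Δ 2)
    {e : Set (Fin n → ℝ)} (he : e ∈ faces Δ 1) (heF : e ⊆ F) : ∃ a, IsContribution Δ F e a := by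
  have hP := hΔ.isPolytope
  obtain ⟨u, hue, hu⟩ := hP.exists_vertex_mem he.2.1 he.1
  obtain ⟨c⟩ := hΔ.exists_chart hu
  obtain ⟨v, hv, hve, hvu, huniq⟩ := exists_other_vertex hP c he hue
  obtain ⟨e₁, p, q, h₁⟩ := hΔ.exists_isCorner hF hu he hue heF
  obtain ⟨e₂, p', q', h₂⟩ := hΔ.exists_isCorner hF hv he hve heF
  obtain ⟨hp, a, ha⟩ := h₁.exists_contribution hP h₂ hvu.symm
  refine ⟨a, fun x y f₁ f₂ r s r' s' hxy k₁ k₂ => ?_⟩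
  rcases huniq x k₁.mem.1 k₁.mem.2 with rfl | rfl <;> rcases huniq y k₂.mem.1 k₂.mem.2 with rfl | rfl
  · exact absurd rfl hxy
  · obtain ⟨rfl, rfl⟩ := h₁.unique hP k₁
    obtain ⟨rfl, rfl⟩ := h₂.unique hP k₂
    exact ha
  · obtain ⟨rfl, rfl⟩ := h₁.unique hP k₂
    obtain ⟨rfl, rfl⟩ := h₂.unique hP k₁
    -- Exchanging the end points negates both `q - q'` and `p`, so `a` is unchanged.
    rw [hp, smul_neg, ← ha, neg_sub]
  · exact absurd rfl hxy

/-! ### Noether's formula for a two-face -/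

/-- A vertex, an edge at it, and the `2`-face `F` containing the edge. -/
def IsFlag (Δ F : Set (Fin n → ℝ)) (x : (Fin n → ℝ) × Set (Fin n → ℝ)) : Prop :=
  x.1 ∈ vertices Δ ∧ x.2 ∈ faces Δ 1 ∧ x.1 ∈ x.2 ∧ x.2 ⊆ F

/-- Each `x` excludes at most one integer `m`. This provides a functional that vanishes on no weight
of the polygon. -/
theorem exists_forall_add_mul_ne_zero {ι : Type*} (X : Finset ι) (a b : ι → ℤ)
    (h : ∀ x ∈ X, a x ≠ 0 ∨ b x ≠ 0) : ∃ m : ℤ, ∀ x ∈ X, a x + m * b x ≠ 0 := by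
  have hfin : (⋃ x ∈ X, {m : ℤ | a x + m * b x = 0}).Finite := by
    refine X.finite_toSet.biUnion fun x hx => Set.Subsingleton.finite ?_
    intro m hm k hk
    have hm' : a x + m * b x = 0 := hm
    have hk' : a x + k * b x = 0 := hk
    have hb : b x ≠ 0 := fun hb => by
      rw [hb, mul_zero, add_zero] at hm'
      exact (h x hx).elim (fun h => h hm') (fun h => h hb)
    exact mul_right_cancel₀ hb (by linarith)
  obtain ⟨m, hm⟩ := hfin.infinite_compl.nonempty
  refine ⟨m, fun x hx h0 => hm ?_⟩
  exact Set.mem_biUnion (s := (X : Set ι)) hx h0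

/-- Summed over flags, this turns the signs into a count of the vertices where the functional or its
negative is minimal. -/
theorem sign_mul_eq_ite {a b : ℤ} (ha : a ≠ 0) (hb : b ≠ 0) : (a * b).sign =
    2 * (if 0 < a ∧ 0 < b then 1 else 0) + 2 * (if 0 < -a ∧ 0 < -b then 1 else 0) - 1 := by
  rw [Int.sign_mul]
  rcases ha.lt_or_gt with h₁ | h₁ <;> rcases hb.lt_or_gt with h₂ | h₂ <;>
    simp [h₁, h₂, h₁.not_gt, h₂.not_gt, Int.sign_eq_one_of_pos,
      Int.sign_eq_neg_one_of_neg]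

/-- Noether's formula for the polygon `F`. -/
theorem IsDelzant.sum_contribution_face (hΔ : IsDelzant Δ) (hF : F ∈ faces Δ 2)
    (E : Finset (Set (Fin n → ℝ))) (hE : ∀ e, e ∈ E ↔ e ∈ faces Δ 1 ∧ e ⊆ F)
    (A : Set (Fin n → ℝ) → ℤ) (hA : ∀ e ∈ E, IsContribution Δ F e (A e)) :
    ∑ e ∈ E, A e = 12 - 3 * (E.card : ℤ) := by
  classical
  have hP := hΔ.isPolytope
  have hXfin : {x | IsFlag Δ F x}.Finite :=
    (hP.finite_vertices.prod (hP.finite_faces 1)).subset fun x hx => ⟨hx.1, hx.2.1⟩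
  let X := hXfin.toFinset
  have hX : ∀ x, x ∈ X ↔ IsFlag Δ F x := fun x => hXfin.mem_toFinset
  have hσ₀ : ∀ x, x ∈ X → ∃ e', (x.1, e') ∈ X ∧ e' ≠ x.2 ∧
      ∀ e'', (x.1, e'') ∈ X → e'' = x.2 ∨ e'' = e' := by
    rintro ⟨v, e⟩ hx
    obtain ⟨hv, he, hve, heF⟩ := (hX _).mp hx
    obtain ⟨e', he', hve', heF', hne, hun⟩ := hΔ.exists_other_edge hF hv he hve heF
    exact ⟨e', (hX _).mpr ⟨hv, he', hve', heF'⟩, hne, fun e'' h => by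
      obtain ⟨-, h1, h2, h3⟩ := (hX _).mp h
      exact hun e'' h1 h2 h3⟩
  have hτ₀ : ∀ x, x ∈ X → ∃ v', (v', x.2) ∈ X ∧ v' ≠ x.1 ∧
      ∀ v'', (v'', x.2) ∈ X → v'' = x.1 ∨ v'' = v' := by
    rintro ⟨v, e⟩ hx
    obtain ⟨hv, he, hve, heF⟩ := (hX _).mp hx
    obtain ⟨c⟩ := hΔ.exists_chart hv
    obtain ⟨v', hv', hve', hne, hun⟩ := exists_other_vertex hP c he hve
    exact ⟨v', (hX _).mpr ⟨hv', he, hve', heF⟩, hne, fun v'' h => by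
      obtain ⟨h1, -, h2, -⟩ := (hX _).mp h
      exact hun v'' h1 h2⟩
  have hω₀ : ∀ x, x ∈ X → ∃ w, IsWeight Δ x.1 x.2 w := fun x hx => by
    obtain ⟨hv, he, hve, -⟩ := (hX _).mp hx
    exact hΔ.exists_isWeight hv he hve
  choose! σ' hσX hσne hσun using hσ₀
  choose! τ' hτX hτne hτun using hτ₀
  choose! ω hω using hω₀
  let σ : (Fin n → ℝ) × Set (Fin n → ℝ) → (Fin n → ℝ) × Set (Fin n → ℝ) := fun x => (x.1, σ' x)
  let τ : (Fin n → ℝ) × Set (Fin n → ℝ) → (Fin n → ℝ) × Set (Fin n → ℝ) := fun x => (τ' x, x.2)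
  have hσσ : ∀ x ∈ X, σ (σ x) = x := by
    intro x hx
    have h1 := hσun x hx (σ (σ x)).2 (hσX _ (hσX x hx))
    exact Prod.ext rfl (h1.resolve_right (hσne _ (hσX x hx)))
  have hττ : ∀ x ∈ X, τ (τ x) = x := by
    intro x hx
    have h1 := hτun x hx (τ (τ x)).1 (hτX _ (hτX x hx))
    exact Prod.ext (h1.resolve_right (hτne _ (hτX x hx))) rfl
  have hcorner : ∀ x ∈ X, IsCorner Δ F x.1 x.2 (σ x).2 (ω x) (ω (σ x)) := by
    intro x hx
    obtain ⟨hv, he, hve, heF⟩ := (hX _).mp hx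
    obtain ⟨-, he', hve', heF'⟩ := (hX _).mp (hσX x hx)
    exact hΔ.isCorner hF hv he he' hve hve' heF heF' (hσne x hx) (hω x hx) (hω _ (hσX x hx))
  have hωτ : ∀ x ∈ X, ω (τ x) = - ω x := fun x hx =>
    ((hcorner x hx).exists_contribution hP (hcorner (τ x) (hτX x hx)) (hτne x hx).symm).1
  have hωA : ∀ x ∈ X, ω (σ x) - ω (σ (τ x)) = A x.2 • ω x := fun x hx =>
    hA x.2 ((hE _).mpr ⟨((hX _).mp hx).2.1, ((hX _).mp hx).2.2.2⟩) _ _ _ _ _ _ _ _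
      (hτne x hx).symm (hcorner x hx) (hcorner (τ x) (hτX x hx))
  -- each functional in general position has exactly one minimal vertex
  have hcount : ∀ ζ : Fin n → ℤ, (∀ x ∈ X, ζ ⬝ᵥ ω x ≠ 0) →
      (X.filter fun x => 0 < ζ ⬝ᵥ ω x ∧ 0 < ζ ⬝ᵥ ω (σ x)).card = 2 := by
    intro ζ hζ
    obtain ⟨v, hvF, hv, hmin⟩ := hP.exists_vertex_forall_le hF.2.1 hF.1 (realDual ζ)
    obtain ⟨e, he, hve, heF⟩ := hΔ.exists_edge_at hF hv hvF
    have hx₀ : (v, e) ∈ X := (hX _).mpr ⟨hv, he, hve, heF⟩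
    have hpos : ∀ x ∈ X, x.1 = v → 0 < ζ ⬝ᵥ ω x := by
      rintro ⟨_, f⟩ hx rfl
      exact ((hcorner _ hx).nonneg_of_forall_le hmin).lt_of_ne (hζ _ hx).symm
    rw [Finset.card_eq_two]
    refine ⟨(v, e), σ (v, e), fun h => hσne _ hx₀ (congrArg Prod.snd h).symm, ?_⟩
    ext x
    rw [Finset.mem_filter, Finset.mem_insert, Finset.mem_singleton]
    constructor
    · rintro ⟨hx, h1, h2⟩
      have hxv : x.1 = v := by
        by_contra hne
        obtain ⟨-, -, h3, h4⟩ := (hX _).mp hx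
        have := (hcorner x hx).lt_of_pos hP h1 h2 hvF (fun h => hne h.symm)
        exact absurd (hmin x.1 (h4 h3)) this.not_ge
      obtain ⟨x₁, x₂⟩ := x
      obtain rfl : x₁ = v := hxv
      exact (hσun _ hx₀ x₂ hx).imp (fun h => Prod.ext rfl h) (fun h => Prod.ext rfl h)
    · rintro (rfl | rfl)
      · exact ⟨hx₀, hpos _ hx₀ rfl, hpos _ (hσX _ hx₀) rfl⟩
      · exact ⟨hσX _ hx₀, hpos _ (hσX _ hx₀) rfl, hpos _ (hσX _ (hσX _ hx₀)) rfl⟩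
  obtain ⟨v₀, hv₀F, hv₀⟩ := hP.exists_vertex_mem hF.2.1 hF.1
  obtain ⟨e₀, he₀, hve₀, heF₀⟩ := hΔ.exists_edge_at hF hv₀ hv₀F
  have hx₀ : (v₀, e₀) ∈ X := (hX _).mpr ⟨hv₀, he₀, hve₀, heF₀⟩
  obtain ⟨ξ, η, hdet⟩ := (hcorner _ hx₀).exists_coordinates
  obtain ⟨m, hm⟩ := exists_forall_add_mul_ne_zero X (fun x => ξ ⬝ᵥ ω x) (fun x => η ⬝ᵥ ω x) (by
    intro x hx
    by_contra! h
    have := hdet _ _ _ _ _ (hcorner x hx)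
    rw [h.1, h.2] at this
    simp at this)
  -- Adding a multiple of `η` to `ξ` makes the functional generic without changing the determinants.
  let ζ := ξ + m • η
  have hζ : ∀ w, ζ ⬝ᵥ w = ξ ⬝ᵥ w + m * (η ⬝ᵥ w) := fun w => by
    rw [add_dotProduct, smul_dotProduct, smul_eq_mul]
  have hζne : ∀ x ∈ X, ζ ⬝ᵥ ω x ≠ 0 := fun x hx => by rw [hζ]; exact hm x hx
  have hdotA : ∀ θ : Fin n → ℤ, ∀ x ∈ X,
      θ ⬝ᵥ ω (σ x) - θ ⬝ᵥ ω (σ (τ x)) = A x.2 * (θ ⬝ᵥ ω x) := fun θ x hx => by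
    rw [← dotProduct_sub, hωA x hx, dotProduct_smul, smul_eq_mul]
  have hmain := sum_contribution_eq_sum_sign X σ τ hσX hτX hσσ hττ (fun x => ζ ⬝ᵥ ω x)
    (fun x => η ⬝ᵥ ω x) (fun x => A x.2) (fun x hx => by rw [hωτ x hx, dotProduct_neg])
    (fun x hx => by rw [hωτ x hx, dotProduct_neg]) (hdotA ζ) (hdotA η)
    (fun x hx => by
      rw [← hdet _ _ _ _ _ (hcorner x hx), hζ, hζ]; ring) hζne
  -- The `8` is `2 * 2 + 2 * 2`: two flags at the minimum of `ζ` and two at that of `-ζ`, each with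
  -- weight `2`.
  have hsign : ∑ x ∈ X, ((ζ ⬝ᵥ ω x) * (ζ ⬝ᵥ ω (σ x))).sign = 8 - (X.card : ℤ) := by
    have hterm : ∀ x ∈ X, ((ζ ⬝ᵥ ω x) * (ζ ⬝ᵥ ω (σ x))).sign =
        2 * (if 0 < ζ ⬝ᵥ ω x ∧ 0 < ζ ⬝ᵥ ω (σ x) then 1 else 0)
        + 2 * (if 0 < (-ζ) ⬝ᵥ ω x ∧ 0 < (-ζ) ⬝ᵥ ω (σ x) then 1 else 0) - 1 := by
      intro x hx
      rw [neg_dotProduct, neg_dotProduct]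
      exact sign_mul_eq_ite (hζne x hx) (hζne (σ x) (hσX x hx))
    rw [Finset.sum_congr rfl hterm, Finset.sum_sub_distrib, Finset.sum_add_distrib,
      ← Finset.mul_sum, ← Finset.mul_sum, Finset.sum_boole, Finset.sum_boole, hcount ζ hζne,
      hcount (-ζ) (fun x hx => by rw [neg_dotProduct, neg_ne_zero]; exact hζne x hx)]
    simp only [Finset.sum_const, nsmul_eq_mul, mul_one, Nat.cast_ofNat]
    ring
  -- Each edge carries two flags, one for each end point.
  have hfib : ∀ g : Set (Fin n → ℝ) → ℤ, ∑ x ∈ X, g x.2 = 2 * ∑ e ∈ E, g e := by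
    intro g
    have hmap : ∀ x ∈ X, x.2 ∈ E := fun x hx =>
      (hE _).mpr ⟨((hX _).mp hx).2.1, ((hX _).mp hx).2.2.2⟩
    rw [← Finset.sum_fiberwise_of_maps_to hmap, Finset.mul_sum]
    refine Finset.sum_congr rfl fun e he => ?_
    obtain ⟨he1, heF⟩ := (hE e).mp he
    obtain ⟨v, hve, hv⟩ := hP.exists_vertex_mem he1.2.1 he1.1
    have hx : (v, e) ∈ X := (hX _).mpr ⟨hv, he1, hve, heF⟩
    have hcard : (X.filter fun x => x.2 = e).card = 2 := by
      rw [Finset.card_eq_two]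
      refine ⟨(v, e), τ (v, e), fun h => hτne _ hx (congrArg Prod.fst h).symm, ?_⟩
      ext y
      rw [Finset.mem_filter, Finset.mem_insert, Finset.mem_singleton]
      constructor
      · rintro ⟨hy, rfl⟩
        exact (hτun _ hx y.1 hy).imp (fun h => Prod.ext h rfl) (fun h => Prod.ext h rfl)
      · rintro (rfl | rfl)
        · exact ⟨hx, rfl⟩
        · exact ⟨hτX _ hx, rfl⟩
    rw [Finset.sum_congr rfl fun x hx => by rw [(Finset.mem_filter.mp hx).2],
      Finset.sum_const, hcard]
    simp
  have hXcard : (X.card : ℤ) = 2 * E.card := by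
    have := hfib fun _ => 1
    simpa using this
  rw [hfib, hsign, hXcard] at hmain
  linarith

/-! ### Normal contributions in arbitrary labelings -/

theorem IsWeights.comp {v : Fin n → ℝ} {w : Fin n → Fin n → ℤ} (h : IsWeights Δ v w)
    (π : Equiv.Perm (Fin n)) : IsWeights Δ v (w ∘ π) := by
  obtain ⟨⟨h1, h2⟩, E, hE⟩ := h
  exact ⟨⟨h1.comp _ π.injective, by rw [π.surjective.range_comp, h2]⟩, π.trans E,
    fun i => hE (π i)⟩

theorem IsDelzant.exists_isWeights_along [NeZero n] (hΔ : IsDelzant Δ) {v : Fin n → ℝ}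
    (hv : v ∈ vertices Δ) {e : Set (Fin n → ℝ)} (he : e ∈ faces Δ 1) (hve : v ∈ e) :
    ∃ w, IsWeights Δ v w ∧ e ⊆ ray v (w 0) := by
  obtain ⟨w, hw⟩ := hΔ.smooth v hv
  obtain ⟨c, rfl⟩ := hw.exists_chart
  obtain ⟨i, rfl⟩ := c.exists_edge_eq he hve
  exact ⟨_, hw.comp (Equiv.swap 0 i), by simpa using c.edge_subset i⟩

theorem IsDelzant.nonempty_edgeFrame [NeZero n] (hΔ : IsDelzant Δ) {e : Set (Fin n → ℝ)}
    (he : e ∈ faces Δ 1) : Nonempty (EdgeFrame Δ e) := by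
  have hP := hΔ.isPolytope
  obtain ⟨u, hue, hu⟩ := hP.exists_vertex_mem he.2.1 he.1
  obtain ⟨c⟩ := hΔ.exists_chart hu
  obtain ⟨v, hv, hve, hvu, -⟩ := exists_other_vertex hP c he hue
  obtain ⟨w, hw, hew⟩ := hΔ.exists_isWeights_along hu he hue
  obtain ⟨w', hw', hew'⟩ := hΔ.exists_isWeights_along hv he hve
  exact ⟨⟨u, v, w, w', hu, hv, hue, hve, hvu.symm, hw, hw', hew, hew'⟩⟩

/-- The normal contribution belonging to the weight `w i` is that in the direction of the `2`-face
spanned by the edges along `w 0` and `w i`. -/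
theorem EdgeFrame.exists_chart [NeZero n] (h : IsPolytope Δ) {e : Set (Fin n → ℝ)}
    (he : e ∈ faces Δ 1) (fr : EdgeFrame Δ e) : ∃ c : Chart Δ fr.u,
      (c.edge 0 : Set (Fin n → ℝ)) = e ∧ ∀ i, i ≠ 0 → ∀ a, IsContribution Δ (c.face {0, i}) e a →
        ∀ b, fr.IsNormalContribution i b ↔ b = a := by
  obtain ⟨c, hc⟩ := fr.weights_u.exists_chart
  obtain ⟨c', hc'⟩ := fr.weights_v.exists_chart
  have hu := fr.u_mem
  have hv := fr.v_mem
  have he0 := c.edge_eq_of_subset he fr.u_mem_edge (i := 0) (by rw [hc]; exact fr.w_along)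
  have he0' := c'.edge_eq_of_subset he fr.v_mem_edge (i := 0) (by rw [hc']; exact fr.w'_along)
  refine ⟨c, he0, fun i hi a ha b => ?_⟩
  have hF : c.face {0, i} ∈ faces Δ 2 := by
    have := c.face_mem_faces h hu {0, i}
    rwa [Finset.card_pair hi.symm] at this
  have heF : e ⊆ c.face {0, i} :=
    he0.symm.subset.trans ((c.edge_subset_face_iff h hu).mpr (by simp))
  obtain ⟨j, hj, hFj⟩ := c'.exists_eq_face_pair h hv hF (i := 0) (by rw [he0']; exact heF)
  have k₁ : IsCorner Δ (c.face {0, i}) fr.u e (c.edge i) (c.w 0) (c.w i) :=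
    ⟨hu, c, 0, i, hi.symm, rfl, he0, rfl, rfl, rfl⟩
  have k₂ : IsCorner Δ (c.face {0, i}) fr.v e (c'.edge j) (c'.w 0) (c'.w j) :=
    ⟨hv, c', 0, j, hj.symm, hFj, he0', rfl, rfl, rfl⟩
  have hneg := (k₁.exists_contribution h k₂ fr.u_ne_v).1
  have hrel := ha _ _ _ _ _ _ _ _ fr.u_ne_v k₁ k₂
  constructor
  · rintro ⟨l, hl, hb⟩
    rw [← hc, ← hc'] at hb
    -- For uniqueness, two candidate relations are subtracted. Pairing with the dual vector `c'.N 0`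
    -- kills the weights `j` and `l`, both different from `0`, and leaves `a = b`.
    have h1 : c'.w j - c'.w l = (a - b) • c'.w 0 := by
      rw [hneg, smul_neg, sub_smul, ← hb, ← hrel]; abel
    have h2 := congrArg (fun x => c'.N 0 ⬝ᵥ x) h1
    simp only [dotProduct_sub, dotProduct_smul, c'.dual, if_neg hj.symm, if_neg hl.symm] at h2
    simp at h2
    linarith
  · rintro rfl
    exact ⟨j, hj, by rw [← hc, ← hc']; exact hrel⟩

/-- The `2`-faces containing an edge at `v` correspond to the other edges at `v`. -/
theorem Chart.sum_face_pair {M : Type*} [AddCommMonoid M] (h : IsPolytope Δ) {v : Fin n → ℝ}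
    (hv : v ∈ vertices Δ) (c : Chart Δ v) (i : Fin n) (T : Finset (Set (Fin n → ℝ)))
    (hT : ∀ F, F ∈ T ↔ F ∈ faces Δ 2 ∧ (c.edge i : Set (Fin n → ℝ)) ⊆ F)
    (g : Set (Fin n → ℝ) → M) :
    ∑ F ∈ T, g F = ∑ j ∈ Finset.univ.erase i, g (c.face {i, j}) := by
  symm
  refine Finset.sum_bij (fun j _ => c.face {i, j}) ?_ ?_ ?_ (fun _ _ => rfl)
  · intro j hj
    refine (hT _).mpr ⟨?_, by rw [c.edge_subset_face_iff h hv]; simp⟩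
    have := c.face_mem_faces h hv {i, j}
    rwa [Finset.card_pair (Finset.ne_of_mem_erase hj).symm] at this
  · intro j hj k hk hjk
    have : (c.edge j : Set (Fin n → ℝ)) ⊆ c.face {i, k} := by
      rw [← hjk, c.edge_subset_face_iff h hv]; simp
    rw [c.edge_subset_face_iff h hv, Finset.mem_insert, Finset.mem_singleton] at this
    exact this.resolve_left (Finset.ne_of_mem_erase hj)
  · intro F hF
    obtain ⟨hF, hi⟩ := (hT F).mp hF
    obtain ⟨j, hj, hFj⟩ := c.exists_eq_face_pair h hv hF hi
    exact ⟨j, Finset.mem_erase.mpr ⟨hj, Finset.mem_univ j⟩, hFj.symm⟩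

end DelzantPolytope

/-! ### Double counting of pairs of an edge and a two-face -/

theorem theorem2p5 (n : ℕ) [NeZero n] (hn : 2 ≤ n) (Δ : Set (Fin n → ℝ))
    (hΔ : DelzantPolytope.IsDelzant Δ) :
    -- all face numbers are finite
    (∀ k : ℕ, (DelzantPolytope.faces Δ k).Finite) ∧
    -- the normal contributions are well defined
    (∀ e ∈ DelzantPolytope.faces Δ 1, Nonempty (DelzantPolytope.EdgeFrame Δ e)) ∧
    (∀ e ∈ DelzantPolytope.faces Δ 1, ∀ fr : DelzantPolytope.EdgeFrame Δ e, ∀ i : Fin n, i ≠ 0 →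
      ∃! a : ℤ, fr.IsNormalContribution i a) ∧
    -- for every labeling of endpoints and weights, their total is as claimed
    (∀ (fr : ∀ e : DelzantPolytope.faces Δ 1, DelzantPolytope.EdgeFrame Δ (e : Set (Fin n → ℝ)))
      (a : DelzantPolytope.faces Δ 1 → Fin n → ℤ),
      (∀ e, ∀ i : Fin n, i ≠ 0 → (fr e).IsNormalContribution i (a e i)) →
      ∑ᶠ e : DelzantPolytope.faces Δ 1, ∑ i ∈ Finset.univ.erase (0 : Fin n), a e i =
        12 * (DelzantPolytope.fVector Δ 2 : ℤ)
          - 3 * ((n : ℤ) - 1) * (DelzantPolytope.fVector Δ 1 : ℤ)) := by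
  classical
  have hP := hΔ.isPolytope
  have hchart : ∀ e ∈ DelzantPolytope.faces Δ 1, ∀ fr : DelzantPolytope.EdgeFrame Δ e,
      ∃ c : DelzantPolytope.Chart Δ fr.u, (c.edge 0 : Set (Fin n → ℝ)) = e ∧
        ∀ i : Fin n, i ≠ 0 → c.face {0, i} ∈ DelzantPolytope.faces Δ 2 ∧ e ⊆ c.face {0, i} ∧
          ∀ a, DelzantPolytope.IsContribution Δ (c.face {0, i}) e a →
            ∀ b, fr.IsNormalContribution i b ↔ b = a := by
    intro e he fr
    obtain ⟨c, hc, h⟩ := fr.exists_chart hP he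
    refine ⟨c, hc, fun i hi => ⟨?_, ?_, h i hi⟩⟩
    · have := c.face_mem_faces hP fr.u_mem {0, i}
      rwa [Finset.card_pair hi.symm] at this
    · exact hc.symm.subset.trans ((c.edge_subset_face_iff hP fr.u_mem).mpr (by simp))
  refine ⟨hP.finite_faces, fun e he => hΔ.nonempty_edgeFrame he, fun e he fr i hi => ?_,
    fun fr a ha => ?_⟩
  · obtain ⟨c, -, hc⟩ := hchart e he fr
    obtain ⟨hF, heF, h⟩ := hc i hi
    obtain ⟨a, ha⟩ := hΔ.exists_isContribution hF he heF
    exact ⟨a, (h a ha a).mpr rfl, fun b hb => (h a ha b).mp hb⟩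
  · let E := (hP.finite_faces 1).toFinset
    let T := (hP.finite_faces 2).toFinset
    have hE : ∀ e, e ∈ E ↔ e ∈ DelzantPolytope.faces Δ 1 := fun e => Set.Finite.mem_toFinset _
    have hT : ∀ F, F ∈ T ↔ F ∈ DelzantPolytope.faces Δ 2 := fun F => Set.Finite.mem_toFinset _
    have hA₀ : ∀ e F, e ∈ DelzantPolytope.faces Δ 1 ∧ F ∈ DelzantPolytope.faces Δ 2 ∧ e ⊆ F →
        ∃ b, DelzantPolytope.IsContribution Δ F e b := fun e F h =>
      hΔ.exists_isContribution h.2.1 h.1 h.2.2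
    choose! A hA using hA₀
    -- `A` depends only on the pair of faces, so the right side no longer involves the frame chosen
    -- at `e`.
    have hsum : ∀ e : DelzantPolytope.faces Δ 1, ∑ i ∈ Finset.univ.erase (0 : Fin n), a e i =
        ∑ F ∈ T.filter fun F => (e : Set (Fin n → ℝ)) ⊆ F, A e F := by
      intro e
      obtain ⟨c, hc0, hc⟩ := hchart e e.2 (fr e)
      rw [c.sum_face_pair hP (fr e).u_mem 0 _ (fun F => by rw [Finset.mem_filter, hT, hc0])]
      refine Finset.sum_congr rfl fun i hi => ?_
      have hi0 := Finset.ne_of_mem_erase hi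
      obtain ⟨hF, heF, h⟩ := hc i hi0
      exact (h _ (hA e _ ⟨e.2, hF, heF⟩) _).mp (ha e i hi0)
    have hcard : ∀ e ∈ E, ((T.filter fun F => e ⊆ F).card : ℤ) = n - 1 := by
      intro e he
      obtain ⟨c, hc0, -⟩ := hchart e ((hE e).mp he) (fr ⟨e, (hE e).mp he⟩)
      rw [Finset.card_eq_sum_ones, c.sum_face_pair hP (fr ⟨e, (hE e).mp he⟩).u_mem 0 _
        (fun F => by rw [Finset.mem_filter, hT, hc0]), ← Finset.card_eq_sum_ones,
        Finset.card_erase_of_mem (Finset.mem_univ _), Finset.card_univ, Fintype.card_fin]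
      omega
    have hswap : ∀ g : Set (Fin n → ℝ) → Set (Fin n → ℝ) → ℤ,
        ∑ e ∈ E, ∑ F ∈ T.filter (fun F => e ⊆ F), g e F =
          ∑ F ∈ T, ∑ e ∈ E.filter (fun e => e ⊆ F), g e F := fun g =>
      Finset.sum_comm' fun e F => by simp only [Finset.mem_filter]; tauto
    have hf1 : DelzantPolytope.fVector Δ 1 = E.card :=
      Set.ncard_eq_toFinset_card _ (hP.finite_faces 1)
    have hf2 : DelzantPolytope.fVector Δ 2 = T.card :=
      Set.ncard_eq_toFinset_card _ (hP.finite_faces 2)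
    rw [finsum_congr hsum, finsum_set_coe_eq_finsum_mem (f := fun e : Set (Fin n → ℝ) =>
      ∑ F ∈ T.filter fun F => e ⊆ F, A e F), finsum_mem_eq_finite_toFinset_sum _
      (hP.finite_faces 1), hswap]
    -- The number of edges of `F` is kept as a sum of ones, so that `hswap` can return it to a sum
    -- over edges, where each contributes `n - 1`.
    have hface : ∀ F ∈ T, ∑ e ∈ E.filter (fun e => e ⊆ F), A e F =
        12 - 3 * ∑ e ∈ E.filter (fun e => e ⊆ F), 1 := by
      intro F hF
      have hmem : ∀ e, e ∈ E.filter (fun e => e ⊆ F) ↔ e ∈ DelzantPolytope.faces Δ 1 ∧ e ⊆ F :=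
        fun e => by rw [Finset.mem_filter, hE]
      rw [hΔ.sum_contribution_face ((hT F).mp hF) _ hmem (fun e => A e F)
        (fun e he => hA e F ⟨((hmem e).mp he).1, (hT F).mp hF, ((hmem e).mp he).2⟩)]
      simp
    rw [Finset.sum_congr rfl hface, Finset.sum_sub_distrib, ← Finset.mul_sum,
      ← hswap fun _ _ => 1]
    have hcount : ∑ e ∈ E, ∑ F ∈ T.filter (fun F => e ⊆ F), (1 : ℤ) = E.card * (n - 1) := by
      rw [Finset.sum_congr rfl fun e he => by
        rw [Finset.sum_const, nsmul_eq_mul, mul_one, hcard e he], Finset.sum_const, nsmul_eq_mul]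
    rw [hcount, hf1, hf2, Finset.sum_const, nsmul_eq_mul]
    ring
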